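/- Work in the ring $\mathbb{Z}[z,z^{-1}][[q]]$ of formal power series in $q$ whose coefficients are integer Laurent polynomials in $z$ (infinite products converge coefficientwise in $q$). Write $$E(q)=\prod_{n\ge 1}(1-q^n),\qquad [x;q]_\infty=\prod_{n\ge 1}(1-xq^{n-1})(1-x^{-1}q^{n}),\qquad [x,y;q]_\infty=[x;q]_\infty\,[y;q]_\infty .$$ Let $a$ and $k$ be integers with $a\ge 2$ and $k\ge 2$. Then the quotient $$(1-z^{k(a+1)})\,E(q)\,E(q^{a+1})^{\lfloor (a+1)/2\rfloor}\,\frac{[z^a;q]_\infty}{[z,z^{a+1};q]_\infty}$$ is a well-defined element of $\mathbb{Z}[z,z^{-1}][[q]]$ (there is exactly one $F$ in this ring whose product with $[z,z^{a+1};q]_\infty$ equals $(1-z^{k(a+1)})E(q)E(q^{a+1})^{\lfloor (a+1)/2\rfloor}[z^a;q]_\infty$), and for all $n\ge 0$ and $m\in\mathbb{Z}$ its coefficient of $z^mq^n$ is nonnegative. -/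

import Mathlib

open scoped LaurentPolynomial PowerSeries PowerSeries.WithPiTopology

namespace QSeries

/-! ### Infinite products `(x;q)_∞`, `[z;q]_∞` and `E(q)` in a topological commutative ring -/

section Products

variable {A : Type*} [CommRing A] [TopologicalSpace A]

/-- `(x;q)_∞ = ∏_{n ≥ 0} (1 - x q^n)`. -/
noncomputable def qPoch (x q : A) : A := ∏' n : ℕ, (1 - x * q ^ n)

/-- `[z;q]_∞ = (z;q)_∞ (z⁻¹ q;q)_∞` for an invertible `z`. -/
noncomputable def bracket (z : Aˣ) (q : A) : A :=
  qPoch (z : A) q * qPoch (((z⁻¹ : Aˣ) : A) * q) q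

/-- `E(q) = ∏_{n ≥ 1} (1 - q^n)`. -/
noncomputable def eulerE (q : A) : A := ∏' n : ℕ, (1 - q ^ (n + 1))

end Products

/-! ### The ring `ℤ[z, z⁻¹][[q]]` -/

/-- Formal power series in `q` whose coefficients are integer Laurent polynomials in `z`. -/
abbrev ZQSeries : Type := PowerSeries (LaurentPolynomial ℤ)

/-- Laurent polynomials carry the discrete topology, so that convergence in `ZQSeries` means
that every coefficient of a power of `q` is eventually constant. -/
instance instTopologicalSpaceLaurent : TopologicalSpace (LaurentPolynomial ℤ) := ⊥

instance instDiscreteTopologyLaurent : DiscreteTopology (LaurentPolynomial ℤ) := ⟨rfl⟩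

/-- The variable `q`. -/
noncomputable def q : ZQSeries := PowerSeries.X

/-- The invertible variable `z`. -/
noncomputable def z : ZQSeriesˣ where
  val := PowerSeries.C (LaurentPolynomial.T 1)
  inv := PowerSeries.C (LaurentPolynomial.T (-1))
  val_inv := by rw [← map_mul, ← LaurentPolynomial.T_add]; simp
  inv_val := by rw [← map_mul, ← LaurentPolynomial.T_add]; simp

/-- `F ⪰ 0`: the coefficient of `z^m q^n` in `F` is nonnegative for all `n ≥ 0` and `m ∈ ℤ`. -/
def Nonneg (F : ZQSeries) : Prop :=
  ∀ (n : ℕ) (m : ℤ), 0 ≤ (PowerSeries.coeff n F).coeff m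

/-! ### The infinite products converge -/

theorem multipliable_one_sub_mul_pow (x : ZQSeries) {p : ZQSeries}
    (hp : PowerSeries.constantCoeff p = 0) : Multipliable fun n : ℕ => 1 - x * p ^ n := by
  simp_rw [sub_eq_add_neg]
  apply PowerSeries.WithPiTopology.multipliable_one_add_of_tendsto_order_atTop_nhds_top
  refine ENat.tendsto_nhds_top_iff_natCast_lt.mpr fun n =>
    Filter.eventually_atTop.mpr ⟨n + 1, fun m hm => ?_⟩
  rw [PowerSeries.order_neg]
  have h1 : (m : ℕ∞) ≤ (p ^ m).order := PowerSeries.le_order_pow_of_constantCoeff_eq_zero m hp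
  have h2 : (p ^ m).order ≤ (x * p ^ m).order :=
    le_trans le_add_self (PowerSeries.le_order_mul (φ := x) (ψ := p ^ m))
  exact lt_of_lt_of_le (by exact_mod_cast hm) (h1.trans h2)

theorem multipliable_one_sub_pow_succ {p : ZQSeries}
    (hp : PowerSeries.constantCoeff p = 0) : Multipliable fun n : ℕ => 1 - p ^ (n + 1) := by
  simpa [pow_succ'] using multipliable_one_sub_mul_pow p hp

end QSeries

/-! Write x = z^(a+1) and Q = q^(a+1). The quotient is decomposed according to the exponent of z
modulo a+1, and each component becomes a product of series with nonnegative coefficients.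

The tool is Kronecker's formula `eulerE_sq_mul_qPoch`, which writes E(q)^2 [uv;q]/([u;q][v;q]) as a
bilateral Lambert series. At u = 1/z, v = z^(a+1) the Lambert series is a double sum over N, M ≥ 1
of monomials z^(±(N-(a+1)M)) q^(NM). Split by N modulo a+1: the multiples of a+1 cancel by the
symmetry of the double sum, and every other class is z^(i+1) times a series in x. By Kronecker's
formula in base Q, that series is in turn governed by the single theta quotient E(Q)^2
[q^(i+1);Q]/([x;Q][q^(i+1)/x;Q]) (`eulerE_sq_mul_bracket`, `eulerE_sq_mul_qPoch_residue`). Hence the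
quotient is the sum over i < a of z^i f_i, where f_i is that theta quotient times (1-x^k)
E(Q)^⌊(a+1)/2⌋ / E(q).

For a non-middle residue, f_i is a product of three nonnegative series (`exists_component`):
(1-x^k)E(Q)/[x;Q], because the crank generating function has its only negative coefficient at x^0 Q,
and 1+x+...+x^(k-1) with k ≥ 2 repairs it (`crank_sub_mem`, `exists_mul_bracket_eq`);
E(Q)/[q^(i+1)/x;Q], by the q-binomial theorem (`eulerE_div_qPoch_mem`); E(Q)^⌊(a+1)/2⌋
[q^(i+1);Q]/E(q), by pairing opposite residues in E(q) (`exists_mul_eulerE`). For the middle residue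
2(i+1) = a+1 the theta functions collapse to base q^(i+1), and generating functions of cores supply
the remaining factor (`exists_middle`, `eulerE_pow_div_eulerE_mem`).

Kronecker's formula itself comes from convolving the theta coefficients at 1 with (1-y)/(1-yQ^n):
the convolution satisfies the recursion of the theta coefficients at y, and its value at 0 is found
from the Laurent expansion of a reciprocal theta function in terms of partial theta series
(`kronConv_eq`, `eulerE_sq_eq`). -/

namespace QSeries

/-! ### Locally finite families -/

/-- A family of power series of which only finitely many members are nonzero modulo any given
power of `q`. -/
def LocFin {ι : Type*} (f : ι → ZQSeries) : Prop := ∀ n : ℕ, {i | ¬ q ^ n ∣ f i}.Finite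

theorem eq_of_forall_dvd_sub {a b : ZQSeries} (h : ∀ n : ℕ, q ^ n ∣ a - b) : a = b := by
  ext1 n
  have := PowerSeries.X_pow_dvd_iff.1 (h (n + 1)) n n.lt_succ_self
  rwa [map_sub, sub_eq_zero] at this

theorem isClosed_setOf_dvd (n : ℕ) : IsClosed {a : ZQSeries | q ^ n ∣ a} := by
  have : {a : ZQSeries | q ^ n ∣ a} = ⋂ m, ⋂ (_ : m < n), {a | PowerSeries.coeff m a = 0} := by
    ext a
    simp [q, PowerSeries.X_pow_dvd_iff]
  rw [this]
  refine isClosed_iInter fun m => isClosed_iInter fun _ => ?_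
  exact isClosed_eq (PowerSeries.WithPiTopology.continuous_coeff _ m) continuous_const

theorem q_dvd_iff {a : ZQSeries} : q ∣ a ↔ PowerSeries.constantCoeff a = 0 :=
  PowerSeries.X_dvd_iff

namespace LocFin

variable {ι κ : Type*} {f g : ι → ZQSeries}

theorem summable (hf : LocFin f) : Summable f := by
  rw [PowerSeries.WithPiTopology.summable_iff_summable_coeff]
  intro d
  refine summable_of_hasFiniteSupport ((hf (d + 1)).subset fun i hi => ?_)
  intro h
  exact hi (PowerSeries.X_pow_dvd_iff.1 h d d.lt_succ_self)

theorem of_dvd (hf : LocFin f) (h : ∀ i, f i ∣ g i) : LocFin g := fun n =>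
  (hf n).subset fun i hi hd => hi (hd.trans (h i))

theorem mul_right (hf : LocFin f) (g : ι → ZQSeries) : LocFin fun i => f i * g i :=
  hf.of_dvd fun _ => dvd_mul_right _ _

theorem mul_left (hf : LocFin f) (g : ι → ZQSeries) : LocFin fun i => g i * f i :=
  hf.of_dvd fun _ => dvd_mul_left _ _

theorem comp (hf : LocFin f) {e : κ → ι} (he : Function.Injective e) :
    LocFin fun k => f (e k) := fun n => (hf n).preimage he.injOn

theorem add (hf : LocFin f) (hg : LocFin g) : LocFin fun i => f i + g i := fun n =>
  ((hf n).union (hg n)).subset fun i hi => by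
    by_contra h
    simp only [Set.mem_union, Set.mem_ofPred_eq, not_or, not_not] at h
    exact hi (dvd_add h.1 h.2)

theorem neg (hf : LocFin f) : LocFin fun i => - f i :=
  hf.of_dvd fun i => (dvd_neg.2 dvd_rfl)

theorem sub (hf : LocFin f) (hg : LocFin g) : LocFin fun i => f i - g i := by
  simpa [sub_eq_add_neg] using hf.add hg.neg

theorem prod {g : κ → ZQSeries} (hf : LocFin f) (hg : LocFin g) :
    LocFin fun p : ι × κ => f p.1 * g p.2 := fun n =>
  ((hf n).prod (hg n)).subset fun p hp =>
    ⟨fun h => hp (h.mul_right _), fun h => hp (h.mul_left _)⟩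

theorem tsum_mul_tsum {g : κ → ZQSeries} (hf : LocFin f) (hg : LocFin g) :
    (∑' i, f i) * ∑' k, g k = ∑' p : ι × κ, f p.1 * g p.2 :=
  hf.summable.tsum_mul_tsum hg.summable (hf.prod hg).summable

theorem fiber {f : ι × κ → ZQSeries} (hf : LocFin f) (i : ι) : LocFin fun k => f (i, k) :=
  hf.comp (Prod.mk_right_injective i)

theorem tsum_prod {f : ι × κ → ZQSeries} (hf : LocFin f) :
    ∑' p, f p = ∑' i, ∑' k, f (i, k) :=
  hf.summable.tsum_prod' fun i => (hf.fiber i).summable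

end LocFin

variable {ι κ : Type*}

theorem pow_dvd_tsum {f : ι → ZQSeries} {n : ℕ} (hf : Summable f) (h : ∀ i, q ^ n ∣ f i) :
    q ^ n ∣ ∑' i, f i :=
  (isClosed_setOf_dvd n).mem_of_tendsto hf.hasSum
    (Filter.Eventually.of_forall fun s => Finset.dvd_sum fun i _ => h i)

theorem LocFin.tsum_fiber {f : ι × κ → ZQSeries} (hf : LocFin f) :
    LocFin fun i => ∑' k, f (i, k) := fun n =>
  ((hf n).image Prod.fst).subset fun i hi => by
    by_contra h
    refine hi (pow_dvd_tsum (hf.fiber i).summable fun k => ?_)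
    by_contra hk
    exact h ⟨(i, k), hk, rfl⟩

theorem locFin_of_tendsto {f : ι → ZQSeries} {d : ι → ℕ}
    (hd : Filter.Tendsto d Filter.cofinite Filter.atTop) (h : ∀ i, q ^ d i ∣ f i) :
    LocFin f := fun n => by
  have := hd.eventually_ge_atTop n
  rw [Filter.eventually_cofinite] at this
  refine this.subset fun i hi hn => hi ((pow_dvd_pow q hn).trans (h i))

theorem locFin_nat {f : ℕ → ZQSeries} (h : ∀ n, q ^ n ∣ f n) : LocFin f :=
  locFin_of_tendsto (d := id) (by rw [Nat.cofinite_eq_atTop]; exact Filter.tendsto_id) h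

theorem locFin_nat_sub {f : ℕ → ZQSeries} (h : ∀ n, q ^ (n - 1) ∣ f n) : LocFin f :=
  locFin_of_tendsto (d := fun n => n - 1)
    (by rw [Nat.cofinite_eq_atTop]; exact Filter.tendsto_sub_atTop_nat 1) h

theorem tendsto_natAbs_sub (c : ℕ) :
    Filter.Tendsto (fun n : ℤ => n.natAbs - c) Filter.cofinite Filter.atTop := by
  rw [Filter.tendsto_atTop]
  intro b
  rw [Filter.eventually_cofinite]
  refine (Set.finite_Icc (-(b + c : ℤ)) (b + c)).subset fun i hi => ?_
  simp only [Set.mem_ofPred_eq, Set.mem_Icc] at *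
  omega

theorem locFin_int (c : ℕ) {f : ℤ → ZQSeries} (h : ∀ n, q ^ (n.natAbs - c) ∣ f n) :
    LocFin f := locFin_of_tendsto (tendsto_natAbs_sub c) h

theorem LocFin.tsum_eq_zero_add {f : ℕ → ZQSeries} (hf : LocFin f) :
    ∑' n, f n = f 0 + ∑' n, f (n + 1) := hf.summable.tsum_eq_zero_add

theorem LocFin.tsum_int {f : ℤ → ZQSeries} (hf : LocFin f) :
    ∑' n, f n = ∑' n : ℕ, f n + ∑' n : ℕ, f (-(n + 1)) :=
  tsum_of_nat_of_neg_add_one (hf.comp Nat.cast_injective).summable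
    (hf.comp (e := fun n : ℕ => -((n : ℤ) + 1)) fun a b h => by simpa using h).summable

/-! ### Inverses of series with constant term one -/

theorem isUnit_of_dvd_sub_one {u : ZQSeries} (h : q ∣ u - 1) : IsUnit u := by
  rw [PowerSeries.isUnit_iff_constantCoeff]
  rw [q_dvd_iff, map_sub, sub_eq_zero] at h
  simp [h]

theorem isUnit_one_sub {x : ZQSeries} (h : q ∣ x) : IsUnit (1 - x) :=
  isUnit_of_dvd_sub_one (by simpa using h)

theorem mul_inverse {u : ZQSeries} (h : IsUnit u) : u * Ring.inverse u = 1 :=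
  Ring.mul_inverse_cancel _ h

theorem locFin_pow {x : ZQSeries} (hx : q ∣ x) : LocFin fun n : ℕ => x ^ n :=
  locFin_nat fun n => pow_dvd_pow_of_dvd hx n

theorem inverse_one_sub {x : ZQSeries} (hx : q ∣ x) :
    Ring.inverse (1 - x) = ∑' n : ℕ, x ^ n := by
  have h := (locFin_pow hx).tsum_eq_zero_add
  simp_rw [pow_succ', pow_zero] at h
  rw [((locFin_pow hx).summable).tsum_mul_left] at h
  have h2 : (1 - x) * ∑' n : ℕ, x ^ n = 1 := by linear_combination h
  exact (isUnit_one_sub hx).mul_left_cancel (by rw [mul_inverse (isUnit_one_sub hx), h2])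

/-! ### The products `(x;q)_∞` -/

theorem hasProd_qPoch (x : ZQSeries) {Q : ZQSeries} (hQ : q ∣ Q) :
    HasProd (fun n : ℕ => 1 - x * Q ^ n) (qPoch x Q) :=
  (multipliable_one_sub_mul_pow x (q_dvd_iff.1 hQ)).hasProd

theorem qPoch_eq_mul (x : ZQSeries) {Q : ZQSeries} (hQ : q ∣ Q) :
    qPoch x Q = (1 - x) * qPoch (x * Q) Q := by
  have h1 := multipliable_one_sub_mul_pow (x * Q) (q_dvd_iff.1 hQ)
  have h2 : (fun n : ℕ => 1 - x * Q * Q ^ n) = fun n : ℕ => 1 - x * Q ^ (n + 1) := by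
    funext n; ring
  rw [qPoch, qPoch, h2]
  rw [h2] at h1
  rw [tprod_eq_zero_mul' (f := fun n : ℕ => 1 - x * Q ^ n) h1, pow_zero, mul_one]

theorem prod_sub_one_dvd {d : ZQSeries} {f : ι → ZQSeries} (s : Finset ι)
    (h : ∀ i ∈ s, d ∣ f i - 1) : d ∣ ∏ i ∈ s, f i - 1 := by
  classical
  induction s using Finset.induction_on with
  | empty => simp
  | insert a s ha ih =>
    rw [Finset.prod_insert ha]
    have h1 := h a (Finset.mem_insert_self a s)
    have h2 := ih fun i hi => h i (Finset.mem_insert_of_mem hi)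
    have : f a * ∏ i ∈ s, f i - 1 = (f a - 1) * ∏ i ∈ s, f i + (∏ i ∈ s, f i - 1) := by ring
    rw [this]
    exact dvd_add (h1.mul_right _) h2

theorem pow_dvd_qPoch_sub_one {x Q : ZQSeries} {n : ℕ} (hQ : q ∣ Q) (hx : q ^ n ∣ x) :
    q ^ n ∣ qPoch x Q - 1 := by
  have h := (isClosed_setOf_dvd n).preimage
    (f := fun a : ZQSeries => a - 1) (continuous_id.sub continuous_const)
  refine h.mem_of_tendsto (hasProd_qPoch x hQ) (Filter.Eventually.of_forall fun s => ?_)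
  refine prod_sub_one_dvd s fun i _ => ?_
  have : 1 - x * Q ^ i - 1 = -(x * Q ^ i) := by ring
  rw [this, dvd_neg]
  exact hx.mul_right _

theorem isUnit_qPoch {x Q : ZQSeries} (hQ : q ∣ Q) (hx : q ∣ x) : IsUnit (qPoch x Q) :=
  isUnit_of_dvd_sub_one (by simpa using pow_dvd_qPoch_sub_one (n := 1) hQ (by simpa using hx))

/-- A sequence with the recursion of `(x Q^n;Q)_∞` and with limit `1` starts at `(x;Q)_∞`. -/
theorem eq_qPoch_of_recursion {x Q : ZQSeries} (hQ : q ∣ Q) (u : ℕ → ZQSeries)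
    (hu : ∀ n, u n = (1 - x * Q ^ n) * u (n + 1)) (h1 : ∀ n, q ^ n ∣ u n - 1) :
    u 0 = qPoch x Q := by
  -- Both sequences obey the same recursion, so their difference is a finite product times the
  -- difference of the n-th tails, and both tails are 1 modulo q^n.
  have hd : ∀ n, u 0 - qPoch x Q =
      (∏ i ∈ Finset.range n, (1 - x * Q ^ i)) * (u n - qPoch (x * Q ^ n) Q) := by
    intro n
    induction n with
    | zero => simp
    | succ n ih =>
      rw [ih, Finset.prod_range_succ, hu n, qPoch_eq_mul (x * Q ^ n) hQ, pow_succ]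
      ring_nf
  refine eq_of_forall_dvd_sub fun n => ?_
  rw [hd n]
  refine Dvd.dvd.mul_left ?_ _
  have h2 := pow_dvd_qPoch_sub_one (n := n) hQ
    ((pow_dvd_pow_of_dvd hQ n).trans (dvd_mul_left (Q ^ n) x))
  simpa using dvd_sub (h1 n) h2

theorem eulerE_eq (Q : ZQSeries) : eulerE Q = qPoch Q Q := by
  simp [eulerE, qPoch, pow_succ']

theorem isUnit_eulerE {Q : ZQSeries} (hQ : q ∣ Q) : IsUnit (eulerE Q) := by
  rw [eulerE_eq]; exact isUnit_qPoch hQ hQ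

/-- `(x;q)_n` -/
noncomputable def finPoch (x Q : ZQSeries) (n : ℕ) : ZQSeries :=
  ∏ i ∈ Finset.range n, (1 - x * Q ^ i)

@[simp] theorem finPoch_zero (x Q : ZQSeries) : finPoch x Q 0 = 1 := by simp [finPoch]

theorem finPoch_succ (x Q : ZQSeries) (n : ℕ) :
    finPoch x Q (n + 1) = finPoch x Q n * (1 - x * Q ^ n) := by
  simp [finPoch, Finset.prod_range_succ]

theorem finPoch_self_succ (Q : ZQSeries) (n : ℕ) :
    finPoch Q Q (n + 1) = finPoch Q Q n * (1 - Q ^ (n + 1)) := by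
  rw [finPoch_succ, pow_succ']

theorem finPoch_mul_qPoch (x : ZQSeries) {Q : ZQSeries} (hQ : q ∣ Q) (n : ℕ) :
    finPoch x Q n * qPoch (x * Q ^ n) Q = qPoch x Q := by
  induction n with
  | zero => simp
  | succ n ih =>
    rw [← ih, qPoch_eq_mul (x * Q ^ n) hQ, finPoch_succ, pow_succ]
    ring_nf

theorem isUnit_finPoch {x Q : ZQSeries} (hx : q ∣ x) (n : ℕ) : IsUnit (finPoch x Q n) :=
  isUnit_of_dvd_sub_one (prod_sub_one_dvd _ fun i _ => by
    have : 1 - x * Q ^ i - 1 = -(x * Q ^ i) := by ring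
    rw [this, dvd_neg]; exact hx.mul_right _)

/-- The reciprocal of `(Q;Q)_n`. -/
noncomputable def invPoch (Q : ZQSeries) (n : ℕ) : ZQSeries := Ring.inverse (finPoch Q Q n)

@[simp] theorem invPoch_zero (Q : ZQSeries) : invPoch Q 0 = 1 := by simp [invPoch]

theorem finPoch_mul_invPoch {Q : ZQSeries} (hQ : q ∣ Q) (n : ℕ) :
    finPoch Q Q n * invPoch Q n = 1 := mul_inverse (isUnit_finPoch hQ n)

theorem one_sub_mul_invPoch_succ {Q : ZQSeries} (hQ : q ∣ Q) (n : ℕ) :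
    (1 - Q ^ (n + 1)) * invPoch Q (n + 1) = invPoch Q n := by
  apply (isUnit_finPoch (Q := Q) hQ n).mul_left_cancel
  rw [← mul_assoc, ← finPoch_self_succ, finPoch_mul_invPoch hQ, finPoch_mul_invPoch hQ]

/-- The `q`-binomial theorem. -/
theorem qPoch_mul_eq_tsum {x Q : ZQSeries} (hQ : q ∣ Q) (hx : q ∣ x) (b : ZQSeries) :
    qPoch (b * x) Q = qPoch x Q * ∑' n : ℕ, finPoch b Q n * invPoch Q n * x ^ n := by
  set c : ℕ → ZQSeries := fun n => finPoch b Q n * invPoch Q n with hc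
  have hlf : ∀ y, q ∣ y → LocFin fun n => c n * y ^ n := fun y hy => (locFin_pow hy).mul_left c
  -- The functional equation under y ↦ yQ, equivalent to (1 - Q^(n+1)) c_(n+1) = (1 - bQ^n) c_n on
  -- coefficients. Iterating it gives the recursion of (bx;Q)_∞.
  have hrec : ∀ y, q ∣ y →
      (1 - y) * ∑' n, c n * y ^ n = (1 - b * y) * ∑' n, c n * (y * Q) ^ n := by
    intro y hy
    have hyQ : q ∣ y * Q := hy.mul_right _
    have e1 : ∑' n, c n * y ^ n - ∑' n, c n * (y * Q) ^ n =
        ∑' n, c n * (1 - Q ^ n) * y ^ n := by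
      rw [← (hlf y hy).summable.tsum_sub (hlf _ hyQ).summable]
      exact tsum_congr fun n => by ring
    have e2 : y * ∑' n, c n * y ^ n - b * y * ∑' n, c n * (y * Q) ^ n =
        ∑' n, c (n + 1) * (1 - Q ^ (n + 1)) * y ^ (n + 1) := by
      rw [← (hlf y hy).summable.tsum_mul_left, ← (hlf _ hyQ).summable.tsum_mul_left,
        ← ((hlf y hy).mul_left _).summable.tsum_sub ((hlf _ hyQ).mul_left _).summable]
      refine tsum_congr fun n => ?_
      have : c (n + 1) * (1 - Q ^ (n + 1)) = c n * (1 - b * Q ^ n) := by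
        simp only [hc]
        rw [mul_assoc, mul_comm (invPoch _ _), one_sub_mul_invPoch_succ hQ, finPoch_succ]
        ring
      rw [this]; ring
    have e3 := ((locFin_pow hy).mul_left fun n => c n * (1 - Q ^ n)).tsum_eq_zero_add
    simp only [pow_zero, sub_self, mul_zero, zero_mul, zero_add] at e3
    linear_combination e1 - e2 + e3
  have hdv : ∀ n, q ∣ x * Q ^ n := fun n => hx.mul_right _
  have key := eq_qPoch_of_recursion (x := b * x) hQ
    (fun n => qPoch (x * Q ^ n) Q * ∑' k, c k * (x * Q ^ n) ^ k) ?_ ?_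
  · simpa using key.symm
  · intro n
    have h := hrec (x * Q ^ n) (hdv n)
    rw [qPoch_eq_mul (x * Q ^ n) hQ, pow_succ, ← mul_assoc x]
    linear_combination qPoch (x * Q ^ n * Q) Q * h
  · intro n
    have h1 : q ^ n ∣ x * Q ^ n := (pow_dvd_pow_of_dvd hQ n).mul_left _
    have h2 := pow_dvd_qPoch_sub_one hQ h1
    have h3 := (hlf _ (hdv n)).tsum_eq_zero_add
    have h4 : q ^ n ∣ ∑' k, c (k + 1) * (x * Q ^ n) ^ (k + 1) :=
      pow_dvd_tsum ((hlf _ (hdv n)).comp (add_left_injective 1)).summable fun k =>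
        (h1.trans (dvd_pow_self _ k.succ_ne_zero)).mul_left _
    simp only [hc, finPoch_zero, invPoch_zero, pow_zero, mul_one] at h3
    simp only [hc] at h4 ⊢
    rw [h3]
    obtain ⟨u, hu⟩ := h2
    obtain ⟨v, hv⟩ := h4
    refine ⟨u + qPoch (x * Q ^ n) Q * v, ?_⟩
    rw [hv]
    linear_combination hu

theorem finPoch_zero_left (Q : ZQSeries) (n : ℕ) : finPoch 0 Q n = 1 := by simp [finPoch]

theorem qPoch_zero (Q : ZQSeries) : qPoch 0 Q = 1 := by simp [qPoch]

/-- Euler's expansion of `1 / (x;Q)_∞`. -/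
theorem inverse_qPoch_eq_tsum {x Q : ZQSeries} (hQ : q ∣ Q) (hx : q ∣ x) :
    Ring.inverse (qPoch x Q) = ∑' n : ℕ, invPoch Q n * x ^ n := by
  have h := qPoch_mul_eq_tsum hQ hx 0
  simp only [zero_mul, qPoch_zero, finPoch_zero_left, one_mul] at h
  apply (isUnit_qPoch hQ hx).mul_left_cancel
  rw [mul_inverse (isUnit_qPoch hQ hx), h]

theorem pow_dvd_pow_choose {Q : ZQSeries} (hQ : q ∣ Q) (n : ℕ) :
    q ^ (n - 1) ∣ Q ^ n.choose 2 := by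
  refine (pow_dvd_pow_of_dvd hQ _).trans (pow_dvd_pow Q ?_)
  cases n with
  | zero => simp
  | succ n => simp [Nat.choose_succ_succ']

/-- Euler's expansion of `(x;Q)_∞`. -/
theorem qPoch_eq_tsum (x : ZQSeries) {Q : ZQSeries} (hQ : q ∣ Q) :
    qPoch x Q = ∑' n : ℕ, Q ^ n.choose 2 * invPoch Q n * (-x) ^ n := by
  obtain ⟨c, hc⟩ : ∃ c : ℕ → ZQSeries, c = fun n => Q ^ n.choose 2 * invPoch Q n := ⟨_, rfl⟩
  have hlf : ∀ g : ℕ → ZQSeries, LocFin fun n => c n * g n := fun g => by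
    rw [hc]
    exact ((locFin_nat_sub (pow_dvd_pow_choose hQ)).mul_right (invPoch Q)).mul_right g
  have hcn : ∀ n, Q ^ n.choose 2 * invPoch Q n = c n := fun n => by rw [hc]
  have hc0 : c 0 = 1 := by simp [hc]
  simp_rw [hcn]
  have hrec : ∀ y, ∑' n, c n * (-y) ^ n = (1 - y) * ∑' n, c n * (-(y * Q)) ^ n := by
    intro y
    have e1 : ∑' n, c n * (-y) ^ n - ∑' n, c n * (-(y * Q)) ^ n =
        ∑' n, c n * ((1 - Q ^ n) * (-y) ^ n) := by
      rw [← (hlf _).summable.tsum_sub (hlf _).summable]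
      refine tsum_congr fun n => ?_
      rw [show -(y * Q) = -y * Q by ring, mul_pow]; ring
    have e2 : -y * ∑' n, c n * (-(y * Q)) ^ n =
        ∑' n, c (n + 1) * ((1 - Q ^ (n + 1)) * (-y) ^ (n + 1)) := by
      rw [← (hlf _).summable.tsum_mul_left]
      refine tsum_congr fun n => ?_
      have : c (n + 1) * (1 - Q ^ (n + 1)) = c n * Q ^ n := by
        simp only [hc]
        rw [mul_assoc, mul_comm (invPoch _ _), one_sub_mul_invPoch_succ hQ,
          Nat.choose_succ_succ', Nat.choose_one_right, pow_add]
        ring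
      rw [show -(y * Q) = -y * Q by ring, mul_pow]
      linear_combination (-(-y) ^ (n + 1)) * this
    have e3 := (hlf fun n => (1 - Q ^ n) * (-y) ^ n).tsum_eq_zero_add
    simp only [pow_zero, sub_self, mul_zero, zero_mul, zero_add] at e3
    linear_combination e1 - e2 + e3
  have key := eq_qPoch_of_recursion (x := x) hQ (fun n => ∑' k, c k * (-(x * Q ^ n)) ^ k) ?_ ?_
  · simpa using key.symm
  · intro n
    rw [hrec (x * Q ^ n), pow_succ, ← mul_assoc x]
  · intro n
    have h1 : q ^ n ∣ -(x * Q ^ n) := (dvd_neg.2 ((pow_dvd_pow_of_dvd hQ n).mul_left _))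
    have h3 := (hlf fun k => (-(x * Q ^ n)) ^ k).tsum_eq_zero_add
    have h4 : q ^ n ∣ ∑' k, c (k + 1) * (-(x * Q ^ n)) ^ (k + 1) :=
      pow_dvd_tsum ((hlf fun k => (-(x * Q ^ n)) ^ k).comp (add_left_injective 1)).summable fun k =>
        (h1.trans (dvd_pow_self _ k.succ_ne_zero)).mul_left _
    rw [hc0, pow_zero, mul_one] at h3
    rw [h3, add_sub_cancel_left]
    exact h4

/-- Splitting `(x;p)_∞` according to residues modulo `t`. -/
theorem qPoch_eq_prod_range (x : ZQSeries) {p : ZQSeries} (hp : q ∣ p) {t : ℕ} (ht : 0 < t) :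
    qPoch x p = ∏ j ∈ Finset.range t, qPoch (x * p ^ j) (p ^ t) := by
  have hpt : q ∣ p ^ t := hp.trans (dvd_pow_self p ht.ne')
  have key := eq_qPoch_of_recursion (x := x) hp
    (fun n => ∏ j ∈ Finset.range t, qPoch (x * p ^ (n + j)) (p ^ t)) ?_ ?_
  · simp only [zero_add] at key
    exact key.symm
  · intro n
    obtain ⟨s, rfl⟩ := Nat.exists_eq_succ_of_ne_zero ht.ne'
    simp only [Nat.succ_eq_add_one]
    rw [Finset.prod_range_succ', Finset.prod_range_succ, add_zero,
      qPoch_eq_mul (x * p ^ n) hpt]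
    rw [Finset.prod_congr rfl fun j _ => by rw [show n + (j + 1) = n + 1 + j by ring]]
    rw [mul_assoc x (p ^ n), ← pow_add, show n + (s + 1) = n + 1 + s by ring]
    ring
  · intro n
    refine prod_sub_one_dvd _ fun j _ => pow_dvd_qPoch_sub_one hpt ?_
    exact (((pow_dvd_pow_of_dvd hp n).trans (pow_dvd_pow p (Nat.le_add_right n j))).mul_left _)

end QSeries

namespace QSeries

/-! ### The Jacobi triple product -/

/-- `n (n - 1) / 2` for an integer `n`. -/
def tri : ℤ → ℕ
  | Int.ofNat n => n.choose 2
  | Int.negSucc n => (n + 2).choose 2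

theorem choose_succ_two (n : ℕ) : (n + 1).choose 2 = n + n.choose 2 := by
  simp [Nat.choose_succ_succ']

theorem tri_natCast (n : ℕ) : tri n = n.choose 2 := rfl

theorem tri_neg_natCast (n : ℕ) : tri (-(n : ℤ)) = (n + 1).choose 2 := by
  cases n <;> rfl

theorem tri_add_one (n : ℤ) : (tri (n + 1) : ℤ) = tri n + n := by
  obtain ⟨k, rfl | rfl⟩ := n.eq_nat_or_neg
  · rw [← Nat.cast_succ, tri_natCast, tri_natCast, Nat.succ_eq_add_one, choose_succ_two]
    push_cast; ring
  · cases k with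
    | zero => simp [tri]
    | succ k =>
      rw [show -((k + 1 : ℕ) : ℤ) + 1 = -(k : ℤ) by push_cast; ring, tri_neg_natCast,
        tri_neg_natCast, choose_succ_two (k + 1)]
      push_cast; ring

theorem natAbs_sub_one_le_tri (n : ℤ) : n.natAbs - 1 ≤ tri n := by
  obtain ⟨k, rfl | rfl⟩ := n.eq_nat_or_neg
  · rw [tri_natCast, Int.natAbs_natCast]
    cases k with
    | zero => simp
    | succ k => rw [choose_succ_two]; omega
  · rw [tri_neg_natCast, Int.natAbs_neg, Int.natAbs_natCast, choose_succ_two]; omega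

theorem add_choose_two (k m : ℕ) : (k + m).choose 2 = k.choose 2 + m.choose 2 + k * m := by
  induction m with
  | zero => simp
  | succ m ih => rw [← add_assoc, choose_succ_two, ih, choose_succ_two]; ring

/-- The terms of the theta series `∑ x^n Q^(n(n-1)/2)` over the integers, where `x'` stands for
`Q / x`. -/
noncomputable def thetaTerm (x x' Q : ZQSeries) : ℤ → ZQSeries
  | Int.ofNat n => x ^ n * Q ^ n.choose 2
  | Int.negSucc n => x' ^ (n + 1) * Q ^ (n + 1).choose 2

theorem thetaTerm_natCast (x x' Q : ZQSeries) (n : ℕ) :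
    thetaTerm x x' Q n = x ^ n * Q ^ n.choose 2 := rfl

theorem thetaTerm_neg_natCast (x x' Q : ZQSeries) (n : ℕ) :
    thetaTerm x x' Q (-(n : ℤ)) = x' ^ n * Q ^ n.choose 2 := by
  cases n with
  | zero => simp [thetaTerm]
  | succ n => rfl

theorem locFin_thetaTerm (x x' : ZQSeries) {Q : ZQSeries} (hQ : q ∣ Q) :
    LocFin (thetaTerm x x' Q) := by
  refine locFin_int 1 fun n => ?_
  obtain ⟨k, rfl | rfl⟩ := n.eq_nat_or_neg
  · rw [thetaTerm_natCast, Int.natAbs_natCast]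
    exact (pow_dvd_pow_choose hQ k).mul_left _
  · rw [thetaTerm_neg_natCast, Int.natAbs_neg, Int.natAbs_natCast]
    exact (pow_dvd_pow_choose hQ k).mul_left _

theorem locFin_tri_shift {Q : ZQSeries} (hQ : q ∣ Q) (d : ℕ) :
    LocFin fun m : ℕ => Q ^ tri ((m : ℤ) - d) :=
  locFin_of_tendsto (d := fun m => m - (d + 1))
    (by rw [Nat.cofinite_eq_atTop]; exact Filter.tendsto_sub_atTop_nat _)
    fun m => (pow_dvd_pow_of_dvd hQ _).trans
      (pow_dvd_pow Q (le_trans (by omega) (natAbs_sub_one_le_tri _)))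

/-- Up to a power of Q this is Euler's expansion of (Q^(-d);Q)_∞, which contains the factor 1 -
Q^(-d)Q^d. Negative powers of Q are avoided by induction on d: after inserting 1 = Q^m + (1 - Q^m),
both parts are multiples of the sum for the previous d. -/
theorem tsum_tri_shift_eq_zero {Q : ZQSeries} (hQ : q ∣ Q) (d : ℕ) :
    ∑' m : ℕ, Q ^ tri ((m : ℤ) - d) * (invPoch Q m * (-1) ^ m) = 0 := by
  have hlf : ∀ (d : ℕ) (g : ℕ → ZQSeries), LocFin fun m : ℕ => Q ^ tri ((m : ℤ) - d) * g m :=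
    fun d g => (locFin_tri_shift hQ d).mul_right g
  induction d with
  | zero =>
    have h := qPoch_eq_tsum 1 hQ
    rw [qPoch_eq_mul 1 hQ, sub_self, zero_mul] at h
    rw [h]
    refine tsum_congr fun m => ?_
    rw [Nat.cast_zero, sub_zero, tri_natCast, mul_assoc]
  | succ d ih =>
    have e1 : Q ^ (d + 1) * ∑' m : ℕ, Q ^ tri ((m : ℤ) - d) * (invPoch Q m * (-1) ^ m) =
        ∑' m : ℕ, Q ^ tri ((m : ℤ) - (d + 1 : ℕ)) * (Q ^ m * (invPoch Q m * (-1) ^ m)) := by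
      rw [← (hlf d _).summable.tsum_mul_left]
      refine tsum_congr fun m => ?_
      have h := tri_add_one ((m : ℤ) - (d + 1 : ℕ))
      rw [show (m : ℤ) - (d + 1 : ℕ) + 1 = (m : ℤ) - d by push_cast; ring] at h
      have hp : Q ^ (d + 1) * Q ^ tri ((m : ℤ) - d) =
          Q ^ tri ((m : ℤ) - (d + 1 : ℕ)) * Q ^ m := by
        rw [← pow_add, ← pow_add]
        congr 1
        push_cast at *
        omega
      linear_combination (invPoch Q m * (-1) ^ m) * hp
    have e2 := (hlf (d + 1) fun m => (1 - Q ^ m) * (invPoch Q m * (-1) ^ m)).tsum_eq_zero_add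
    have e3 : ∑' m : ℕ, Q ^ tri (((m + 1 : ℕ) : ℤ) - (d + 1 : ℕ)) *
        ((1 - Q ^ (m + 1)) * (invPoch Q (m + 1) * (-1) ^ (m + 1))) =
        - ∑' m : ℕ, Q ^ tri ((m : ℤ) - d) * (invPoch Q m * (-1) ^ m) := by
      rw [← tsum_neg]
      refine tsum_congr fun m => ?_
      rw [show ((m + 1 : ℕ) : ℤ) - (d + 1 : ℕ) = (m : ℤ) - d by push_cast; ring,
        ← one_sub_mul_invPoch_succ hQ m]
      ring
    have e4 : ∑' m : ℕ, Q ^ tri ((m : ℤ) - (d + 1 : ℕ)) * (invPoch Q m * (-1) ^ m) =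
        ∑' m : ℕ, Q ^ tri ((m : ℤ) - (d + 1 : ℕ)) * (Q ^ m * (invPoch Q m * (-1) ^ m)) +
        ∑' m : ℕ, Q ^ tri ((m : ℤ) - (d + 1 : ℕ)) * ((1 - Q ^ m) * (invPoch Q m * (-1) ^ m)) := by
      rw [← (hlf (d + 1) _).summable.tsum_add (hlf (d + 1) _).summable]
      exact tsum_congr fun m => by ring
    rw [e4, ← e1, ih, e2, e3, ih]
    simp

theorem eulerE_mul_invPoch {Q : ZQSeries} (hQ : q ∣ Q) (n : ℕ) :
    eulerE Q * invPoch Q n = qPoch (Q ^ (n + 1)) Q := by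
  rw [eulerE_eq, ← finPoch_mul_qPoch Q hQ n, pow_succ']
  linear_combination qPoch (Q * Q ^ n) Q * finPoch_mul_invPoch hQ n

/-- The equivalence `(e, m) ↦ (e + m, m)`. -/
def shearEquiv : ℤ × ℕ ≃ ℤ × ℕ where
  toFun p := (p.1 + p.2, p.2)
  invFun p := (p.1 - p.2, p.2)
  left_inv p := by simp
  right_inv p := by simp

/-- The Jacobi triple product identity. -/
theorem jacobi_triple_product {x x' Q : ZQSeries} (hx : x * x' = Q) (hx' : q ∣ x') :
    eulerE Q * (qPoch (-x) Q * qPoch (-x') Q) = ∑' n, thetaTerm x x' Q n := by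
  have hQ : q ∣ Q := hx ▸ hx'.mul_left x
  have hB := (locFin_thetaTerm x x' hQ).prod
    (g := fun m : ℕ => invPoch Q m * (-x') ^ m) ((locFin_pow (dvd_neg.2 hx')).mul_left _)
  have hB' := hB.comp shearEquiv.injective
  -- Divide the theta series by (-x';Q)_∞ and collect terms by e = n - m, which is the net exponent
  -- of x because x x' = Q.
  have h1 : (∑' n, thetaTerm x x' Q n) * Ring.inverse (qPoch (-x') Q) =
      ∑' e : ℤ, ∑' m : ℕ, thetaTerm x x' Q (e + m) * (invPoch Q m * (-x') ^ m) := by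
    rw [inverse_qPoch_eq_tsum hQ (dvd_neg.2 hx'), (locFin_thetaTerm x x' hQ).tsum_mul_tsum
      ((locFin_pow (dvd_neg.2 hx')).mul_left _), ← shearEquiv.tsum_eq]
    exact hB'.tsum_prod
  -- Negative net exponents contribute nothing: each such sum is a power of x' times the vanishing
  -- sum above.
  have h2 : ∀ d : ℕ, ∑' m : ℕ, thetaTerm x x' Q (-((d : ℤ) + 1) + m) *
      (invPoch Q m * (-x') ^ m) = 0 := by
    intro d
    have := congr_arg (x' ^ (d + 1) * ·) (tsum_tri_shift_eq_zero hQ d)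
    simp only [mul_zero] at this
    rw [← this, ← ((locFin_tri_shift hQ d).mul_right _).summable.tsum_mul_left]
    refine tsum_congr fun m => ?_
    have h3 : thetaTerm x x' Q (-((d : ℤ) + 1) + m) * x' ^ m =
        x' ^ (d + 1) * Q ^ tri ((m : ℤ) - d) := by
      rcases le_total m d with h | h
      · obtain ⟨j, rfl⟩ := Nat.exists_eq_add_of_le h
        rw [show -(((m + j : ℕ) : ℤ) + 1) + m = -((j + 1 : ℕ) : ℤ) by push_cast; ring,
          show (m : ℤ) - (m + j : ℕ) = -(j : ℤ) by push_cast; ring, thetaTerm_neg_natCast,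
          tri_neg_natCast]
        ring
      · obtain ⟨i, rfl⟩ := Nat.exists_eq_add_of_le h
        rw [show ((d + i : ℕ) : ℤ) - d = (i : ℕ) by push_cast; ring, tri_natCast]
        cases i with
        | zero =>
          rw [show -((d : ℤ) + 1) + (d + 0 : ℕ) = -(1 : ℕ) by push_cast; ring,
            thetaTerm_neg_natCast]
          simp [pow_succ]; ring
        | succ i =>
          rw [show -((d : ℤ) + 1) + (d + (i + 1) : ℕ) = (i : ℕ) by push_cast; ring,
            thetaTerm_natCast, choose_succ_two, pow_add Q, ← hx]
          ring
    rw [neg_pow]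
    linear_combination (invPoch Q m * (-1) ^ m) * h3
  -- The nonnegative exponents rebuild E(Q)(-x;Q)_∞: apply Euler's expansion to (-x;Q)_∞, and again
  -- to E(Q)/(Q;Q)_k = (Q^(k+1);Q)_∞.
  have h4 : eulerE Q * qPoch (-x) Q =
      ∑' k : ℕ, ∑' m : ℕ, thetaTerm x x' Q ((k : ℤ) + m) * (invPoch Q m * (-x') ^ m) := by
    have hl : LocFin fun n : ℕ => Q ^ n.choose 2 * invPoch Q n * (- -x) ^ n :=
      ((locFin_nat_sub (pow_dvd_pow_choose hQ)).mul_right (invPoch Q)).mul_right _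
    rw [qPoch_eq_tsum (-x) hQ, ← hl.summable.tsum_mul_left]
    refine tsum_congr fun k => ?_
    have hl2 : LocFin fun m : ℕ => Q ^ m.choose 2 * invPoch Q m * (-(Q ^ (k + 1))) ^ m :=
      ((locFin_nat_sub (pow_dvd_pow_choose hQ)).mul_right (invPoch Q)).mul_right _
    have e1 : eulerE Q * (Q ^ k.choose 2 * invPoch Q k * (- -x) ^ k) =
        Q ^ k.choose 2 * x ^ k * (eulerE Q * invPoch Q k) := by rw [neg_neg]; ring
    rw [e1, eulerE_mul_invPoch hQ, qPoch_eq_tsum _ hQ, ← hl2.summable.tsum_mul_left]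
    refine tsum_congr fun m => ?_
    rw [← Nat.cast_add, thetaTerm_natCast, add_choose_two, neg_pow, neg_pow x']
    have e2 : (Q ^ (k + 1)) ^ m = Q ^ (k * m) * (x ^ m * x' ^ m) := by
      rw [← mul_pow, hx]; ring
    rw [e2]
    ring
  have h5 := hB'.tsum_fiber.tsum_int
  simp only [shearEquiv, Equiv.coe_fn_mk] at h5
  have h6 := mul_inverse (isUnit_qPoch hQ (dvd_neg.2 hx'))
  rw [h5, ← h4, tsum_congr h2, tsum_zero, add_zero] at h1
  linear_combination (-qPoch (-x') Q) * h1 + (∑' n, thetaTerm x x' Q n) * h6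

end QSeries

namespace QSeries

theorem LocFin.tsum_comm {ι κ : Type*} {f : ι × κ → ZQSeries} (hf : LocFin f) :
    ∑' i, ∑' k, f (i, k) = ∑' k, ∑' i, f (i, k) := by
  rw [← hf.tsum_prod, ← (Equiv.prodComm κ ι).tsum_eq,
    (hf.comp (Equiv.prodComm κ ι).injective).tsum_prod]
  rfl

theorem locFin_nat_prod {f : ℕ × ℕ → ZQSeries} (h : ∀ p, q ^ (p.1 + p.2) ∣ f p) : LocFin f :=
  ((locFin_nat (f := fun n => q ^ n) fun _ => dvd_rfl).prod
    (locFin_nat (f := fun n => q ^ n) fun _ => dvd_rfl)).of_dvd fun p => by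
      rw [← pow_add]; exact h p

/-! ### Partial theta series -/

/-- `∑ (-1)^j Q^(j(j+1)/2+jd)` over `j ≥ 0`. -/
noncomputable def partialTheta (Q : ZQSeries) (d : ℕ) : ZQSeries :=
  ∑' j : ℕ, Q ^ (j + 1).choose 2 * ((-1) ^ j * Q ^ (j * d))

/-- `∑ Q^j / ((Q;Q)_j (Q;Q)_{j+d})` over `j ≥ 0`. -/
noncomputable def rankSum (Q : ZQSeries) (d : ℕ) : ZQSeries :=
  ∑' j : ℕ, Q ^ j * (invPoch Q j * invPoch Q (j + d))

section

variable {Q : ZQSeries}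

theorem pow_dvd_pow_choose_succ (hQ : q ∣ Q) (n : ℕ) : q ^ n ∣ Q ^ (n + 1).choose 2 := by
  simpa using pow_dvd_pow_choose hQ (n + 1)

theorem locFin_pow_choose_succ_mul (hQ : q ∣ Q) (g : ℕ → ZQSeries) :
    LocFin fun j : ℕ => Q ^ (j + 1).choose 2 * g j :=
  (locFin_nat (pow_dvd_pow_choose_succ hQ)).mul_right g

theorem locFin_pow_mul (hQ : q ∣ Q) (g : ℕ → ZQSeries) : LocFin fun j : ℕ => Q ^ j * g j :=
  (locFin_pow hQ).mul_right g

theorem partialTheta_sub_one (hQ : q ∣ Q) (d : ℕ) :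
    partialTheta Q d - 1 = ∑' j : ℕ, Q ^ (j + 2).choose 2 * ((-1) ^ (j + 1) * Q ^ ((j + 1) * d)) := by
  rw [partialTheta, (locFin_pow_choose_succ_mul hQ _).tsum_eq_zero_add]
  simp

theorem partialTheta_rec (hQ : q ∣ Q) (d : ℕ) :
    partialTheta Q d - 1 = -(Q ^ (d + 1) * partialTheta Q (d + 1)) := by
  rw [partialTheta_sub_one hQ, partialTheta,
    ← (locFin_pow_choose_succ_mul hQ _).summable.tsum_mul_left, ← tsum_neg]
  refine tsum_congr fun j => ?_
  rw [choose_succ_two (j + 1)]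
  ring

theorem rankSum_shift (hQ : q ∣ Q) (d : ℕ) :
    ∑' j : ℕ, Q ^ j * ((1 - Q ^ j) * (invPoch Q j * invPoch Q (j + d))) =
      Q * rankSum Q (d + 1) := by
  rw [(locFin_pow_mul hQ _).tsum_eq_zero_add, rankSum,
    ← (locFin_pow_mul hQ _).summable.tsum_mul_left]
  simp only [pow_zero, sub_self, zero_mul, mul_zero, zero_add]
  refine tsum_congr fun j => ?_
  rw [← one_sub_mul_invPoch_succ hQ j, show j + 1 + d = j + (d + 1) by ring]
  ring

/-- Two contiguous relations combined: one writes 1/(Q;Q)_(j+d) as (1 - Q^(j+d+1))/(Q;Q)_(j+d+1),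
the other is `rankSum_shift`. The recursion says that the combination on the left does not depend on
d. -/
theorem rankSum_rec (hQ : q ∣ Q) (d : ℕ) :
    rankSum Q d + Q ^ (d + 1) * rankSum Q (d + 1) =
      rankSum Q (d + 1) + Q ^ (d + 2) * rankSum Q (d + 2) := by
  have h1 := rankSum_shift hQ (d + 1)
  have h2 : rankSum Q d = rankSum Q (d + 1) -
      Q ^ (d + 1) * ∑' j : ℕ, Q ^ j * (Q ^ j * (invPoch Q j * invPoch Q (j + (d + 1)))) := by
    rw [rankSum, rankSum, ← (locFin_pow_mul hQ _).summable.tsum_mul_left,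
      ← (locFin_pow_mul hQ _).summable.tsum_sub ((locFin_pow_mul hQ _).mul_left _).summable]
    refine tsum_congr fun j => ?_
    rw [← one_sub_mul_invPoch_succ hQ (j + d), ← add_assoc]
    ring
  have h3 : rankSum Q (d + 1) -
      ∑' j : ℕ, Q ^ j * (Q ^ j * (invPoch Q j * invPoch Q (j + (d + 1)))) =
      ∑' j : ℕ, Q ^ j * ((1 - Q ^ j) * (invPoch Q j * invPoch Q (j + (d + 1)))) := by
    rw [rankSum, ← (locFin_pow_mul hQ _).summable.tsum_sub (locFin_pow_mul hQ _).summable]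
    exact tsum_congr fun j => by ring
  linear_combination h2 + Q ^ (d + 1) * (h3 + h1)

/-- The combination is constant in d, so it may be evaluated as d → ∞: there 1/(Q;Q)_(j+d) tends to
1/E(Q), and the sum of Q^j/(Q;Q)_j is 1/E(Q). -/
theorem eulerE_sq_mul_rankSum_add (hQ : q ∣ Q) (d : ℕ) :
    eulerE Q ^ 2 * (rankSum Q d + Q ^ (d + 1) * rankSum Q (d + 1)) = 1 := by
  have hconst : ∀ n, rankSum Q d + Q ^ (d + 1) * rankSum Q (d + 1) =
      rankSum Q (d + n) + Q ^ (d + n + 1) * rankSum Q (d + n + 1) := by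
    intro n
    induction n with
    | zero => rfl
    | succ n ih => rw [ih, rankSum_rec hQ]; rfl
  refine eq_of_forall_dvd_sub fun n => ?_
  have h1 : eulerE Q * ∑' j : ℕ, Q ^ j * invPoch Q j = 1 := by
    have := inverse_qPoch_eq_tsum hQ hQ
    rw [tsum_congr fun j : ℕ => mul_comm (Q ^ j) (invPoch Q j), ← this, ← eulerE_eq]
    exact mul_inverse (isUnit_eulerE hQ)
  have h2 : q ^ n ∣ eulerE Q * rankSum Q (d + n) - ∑' j : ℕ, Q ^ j * invPoch Q j := by
    rw [rankSum, ← (locFin_pow_mul hQ _).summable.tsum_mul_left,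
      ← ((locFin_pow_mul hQ _).mul_left _).summable.tsum_sub (locFin_pow_mul hQ _).summable]
    refine pow_dvd_tsum (((locFin_pow_mul hQ _).mul_left _).sub (locFin_pow_mul hQ _)).summable
      fun j => ?_
    have e : eulerE Q * (Q ^ j * (invPoch Q j * invPoch Q (j + (d + n)))) - Q ^ j * invPoch Q j =
        (eulerE Q * invPoch Q (j + (d + n)) - 1) * (Q ^ j * invPoch Q j) := by ring
    rw [e, eulerE_mul_invPoch hQ]
    refine Dvd.dvd.mul_right (pow_dvd_qPoch_sub_one hQ ?_) _
    exact (pow_dvd_pow_of_dvd hQ n).trans (pow_dvd_pow Q (by omega))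
  have h3 : q ^ n ∣ Q ^ (d + n + 1) :=
    (pow_dvd_pow_of_dvd hQ n).trans (pow_dvd_pow Q (by omega))
  obtain ⟨u, hu⟩ := h2
  obtain ⟨v, hv⟩ := h3
  rw [hconst n, hv]
  refine ⟨eulerE Q * u + eulerE Q ^ 2 * (v * rankSum Q (d + n + 1)), ?_⟩
  linear_combination eulerE Q * hu + h1

/-- Both sides satisfy S_d = 1 - Q^(d+1) S_(d+1); iterating makes their difference divisible by
every power of q. -/
theorem eulerE_sq_mul_rankSum (hQ : q ∣ Q) (d : ℕ) :
    eulerE Q ^ 2 * rankSum Q d = partialTheta Q d := by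
  have hrec : ∀ d, eulerE Q ^ 2 * rankSum Q d - partialTheta Q d =
      -Q ^ (d + 1) * (eulerE Q ^ 2 * rankSum Q (d + 1) - partialTheta Q (d + 1)) := by
    intro d
    linear_combination eulerE_sq_mul_rankSum_add hQ d - partialTheta_rec hQ d
  have hdvd : ∀ n d, q ^ n ∣ eulerE Q ^ 2 * rankSum Q d - partialTheta Q d := by
    intro n
    induction n with
    | zero => simp
    | succ n ih =>
      intro d
      rw [hrec d, pow_succ']
      exact mul_dvd_mul (dvd_neg.2 (hQ.trans (dvd_pow_self Q d.succ_ne_zero))) (ih _)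
  exact eq_of_forall_dvd_sub fun n => hdvd n d

/-- `∑ Q^(2j) / ((Q;Q)_j (Q;Q)_{j+d})` over `j ≥ 0`. -/
noncomputable def crankSum (Q : ZQSeries) (d : ℕ) : ZQSeries :=
  ∑' j : ℕ, Q ^ j * (Q ^ j * (invPoch Q j * invPoch Q (j + d)))

theorem eulerE_sq_mul_crankSum (hQ : q ∣ Q) (d : ℕ) :
    eulerE Q ^ 2 * crankSum Q d = partialTheta Q d - Q * partialTheta Q (d + 1) := by
  have h : crankSum Q d = rankSum Q d - Q * rankSum Q (d + 1) := by
    rw [← rankSum_shift hQ, crankSum, rankSum,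
      ← (locFin_pow_mul hQ _).summable.tsum_sub (locFin_pow_mul hQ _).summable]
    exact tsum_congr fun j => by ring
  rw [h, ← eulerE_sq_mul_rankSum hQ, ← eulerE_sq_mul_rankSum hQ]
  ring

end

/-- The equivalence sending `(d, m)` to the pair with difference `d` and minimum `m`. -/
def differenceEquiv : ℤ × ℕ ≃ ℕ × ℕ where
  toFun p := (p.2 + p.1.toNat, p.2 + (-p.1).toNat)
  invFun p := ((p.1 : ℤ) - p.2, min p.1 p.2)
  left_inv p := by ext <;> simp <;> omega
  right_inv p := by ext <;> simp <;> omega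

/-- The reciprocal of `(yQ;Q)_∞ (Q/y;Q)_∞` as a Laurent series in `y`. -/
theorem inverse_qPoch_mul_inverse_qPoch {y y' Q : ZQSeries} (hy : y * y' = Q) (hy' : q ∣ y') :
    Ring.inverse (qPoch (y * Q) Q) * Ring.inverse (qPoch y' Q) =
      ∑' m : ℕ, (y * Q) ^ m * crankSum Q m + ∑' m : ℕ, y' ^ (m + 1) * crankSum Q (m + 1) := by
  have hQ : q ∣ Q := hy ▸ hy'.mul_left y
  have hyQ : q ∣ y * Q := hQ.mul_left y
  have h1 := (locFin_pow hyQ).mul_left (invPoch Q)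
  have h2 := (locFin_pow hy').mul_left (invPoch Q)
  rw [inverse_qPoch_eq_tsum hQ hyQ, inverse_qPoch_eq_tsum hQ hy', h1.tsum_mul_tsum h2,
    -- Index the double Euler expansion by the difference of the two exponents, which is the power
    -- of y, and by their minimum, which is the summation index of `crankSum`.
    ← differenceEquiv.tsum_eq]
  have h3 := (h1.prod h2).comp differenceEquiv.injective
  rw [h3.tsum_prod, h3.tsum_fiber.tsum_int]
  congr 1
  · refine tsum_congr fun d => ?_
    rw [crankSum, ← (locFin_pow_mul hQ _).summable.tsum_mul_left]
    refine tsum_congr fun m => ?_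
    simp only [differenceEquiv, Equiv.coe_fn_mk, Int.toNat_natCast, Int.toNat_neg_natCast,
      add_zero]
    have : (y * Q) ^ m * y' ^ m = Q ^ m * Q ^ m := by
      rw [← mul_pow, ← mul_pow, mul_right_comm, hy]
    linear_combination (invPoch Q (m + d) * invPoch Q m * (y * Q) ^ d) * this
  · refine tsum_congr fun d => ?_
    rw [crankSum, ← (locFin_pow_mul hQ _).summable.tsum_mul_left]
    refine tsum_congr fun m => ?_
    have e1 : (-((d : ℤ) + 1)).toNat = 0 := by omega
    have e2 : (- -((d : ℤ) + 1)).toNat = d + 1 := by omega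
    simp only [differenceEquiv, Equiv.coe_fn_mk, e1, e2, add_zero]
    have : (y * Q) ^ m * y' ^ m = Q ^ m * Q ^ m := by
      rw [← mul_pow, ← mul_pow, mul_right_comm, hy]
    linear_combination (invPoch Q (m + (d + 1)) * invPoch Q m * y' ^ (d + 1)) * this

end QSeries

namespace QSeries

/-! ### Kronecker's bilateral series -/

/-- `(1 - y) / (1 - y Q^n)` for an integer `n`, where `y'` stands for `Q / y`. -/
noncomputable def kronTerm (y y' Q : ZQSeries) : ℤ → ZQSeries
  | Int.ofNat 0 => 1
  | Int.ofNat (n + 1) => (1 - y) * Ring.inverse (1 - y * Q ^ (n + 1))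
  | Int.negSucc n => -((1 - y) * (y' * Q ^ n * Ring.inverse (1 - y' * Q ^ n)))

/-- The terms `(-1)^n Q^(n(n-1)/2)` of the theta series at `x = 1`. -/
noncomputable def signTheta (Q : ZQSeries) (n : ℤ) : ZQSeries :=
  (((-1 : ZQSeriesˣ) ^ n : ZQSeriesˣ) : ZQSeries) * Q ^ tri n

/-- The convolution of the theta coefficients with `kronTerm`. -/
noncomputable def kronConv (y y' Q : ZQSeries) (n : ℤ) : ZQSeries :=
  ∑' j : ℤ, signTheta Q j * kronTerm y y' Q (n - j)

section

variable {y y' Q : ZQSeries}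

theorem signTheta_natCast (n : ℕ) : signTheta Q n = (-1) ^ n * Q ^ n.choose 2 := by
  simp [signTheta, tri_natCast]

theorem signTheta_neg_natCast (n : ℕ) :
    signTheta Q (-(n : ℤ)) = (-1) ^ n * Q ^ (n + 1).choose 2 := by
  have : ((-1 : ZQSeriesˣ) ^ n)⁻¹ = (-1) ^ n := by
    rw [← inv_pow]; simp
  rw [signTheta, tri_neg_natCast, zpow_neg, zpow_natCast, this]
  simp

theorem locFin_signTheta (hQ : q ∣ Q) : LocFin (signTheta Q) :=
  (locFin_int (f := fun n => Q ^ tri n) 1 fun n => (pow_dvd_pow_of_dvd hQ _).trans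
    (pow_dvd_pow Q (natAbs_sub_one_le_tri n))).mul_left _

theorem signTheta_mul_zpow (x : ZQSeriesˣ) (n : ℤ) :
    signTheta Q n * ((x ^ n : ZQSeriesˣ) : ZQSeries) =
      thetaTerm (-(x : ZQSeries)) (-(((x⁻¹ : ZQSeriesˣ) : ZQSeries) * Q)) Q n := by
  obtain ⟨k, rfl | rfl⟩ := n.eq_nat_or_neg
  · rw [signTheta_natCast, thetaTerm_natCast, neg_pow (x : ZQSeries), zpow_natCast,
      Units.val_pow_eq_pow_val]
    ring
  · rw [signTheta_neg_natCast, thetaTerm_neg_natCast, neg_pow (_ * Q), choose_succ_two, zpow_neg,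
      zpow_natCast, ← inv_pow, Units.val_pow_eq_pow_val]
    ring

theorem tsum_signTheta_mul_zpow (x : ZQSeriesˣ) (hQ : q ∣ Q) :
    ∑' n, signTheta Q n * ((x ^ n : ZQSeriesˣ) : ZQSeries) =
      eulerE Q * (qPoch (x : ZQSeries) Q * qPoch (((x⁻¹ : ZQSeriesˣ) : ZQSeries) * Q) Q) := by
  have h := jacobi_triple_product (x := -(x : ZQSeries))
    (x' := -(((x⁻¹ : ZQSeriesˣ) : ZQSeries) * Q)) (Q := Q)
    (by rw [neg_mul_neg, ← mul_assoc, Units.mul_inv, one_mul]) (dvd_neg.2 (hQ.mul_left _))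
  rw [neg_neg, neg_neg] at h
  rw [h]
  exact tsum_congr fun n => signTheta_mul_zpow x n

/-- The theta function vanishes at x = 1. -/
theorem tsum_signTheta (hQ : q ∣ Q) : ∑' n, signTheta Q n = 0 := by
  have h := tsum_signTheta_mul_zpow 1 hQ
  simp only [one_zpow, Units.val_one, mul_one] at h
  rw [h, qPoch_eq_mul 1 hQ]
  simp

local notation "K" => FractionRing ZQSeries

/-- In the fraction field Q^n makes sense for negative n, so one equation covers all three branches
of `kronTerm`. -/
theorem kronTerm_mul (hy : y * y' = Q) (hy' : q ∣ y') (hQ0 : Q ≠ 0) (n : ℤ) :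
    algebraMap ZQSeries K (kronTerm y y' Q n) *
      (1 - algebraMap ZQSeries K y * algebraMap ZQSeries K Q ^ n) =
      1 - algebraMap ZQSeries K y := by
  have hQ : q ∣ Q := hy ▸ hy'.mul_left y
  have hinj := IsFractionRing.injective ZQSeries K
  have hQK : algebraMap ZQSeries K Q ≠ 0 := by
    rwa [Ne, map_eq_zero_iff _ hinj]
  cases n with
  | ofNat n =>
    rw [Int.ofNat_eq_natCast, zpow_natCast]
    cases n with
    | zero => simp [kronTerm]
    | succ n =>
      have h : (1 - y) * Ring.inverse (1 - y * Q ^ (n + 1)) * (1 - y * Q ^ (n + 1)) = 1 - y := by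
        rw [mul_assoc, Ring.inverse_mul_cancel, mul_one]
        exact isUnit_one_sub ((hQ.trans (dvd_pow_self Q n.succ_ne_zero)).mul_left y)
      have h2 := congr_arg (algebraMap ZQSeries K) h
      simp only [map_mul, map_sub, map_one, map_pow] at h2
      simpa [kronTerm] using h2
  | negSucc n =>
    have h : (1 - y' * Q ^ n) * Ring.inverse (1 - y' * Q ^ n) = 1 :=
      mul_inverse (isUnit_one_sub (hy'.mul_right _))
    have h2 := congr_arg (algebraMap ZQSeries K) h
    have h3 := congr_arg (algebraMap ZQSeries K) hy
    simp only [map_mul, map_sub, map_one, map_pow] at h2 h3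
    simp only [kronTerm, map_mul, map_sub, map_one, map_pow, map_neg, zpow_negSucc]
    set Y := algebraMap ZQSeries K y
    set Y' := algebraMap ZQSeries K y'
    set QQ := algebraMap ZQSeries K Q
    set I := algebraMap ZQSeries K (Ring.inverse (1 - y' * Q ^ n))
    have h4 : Y' * QQ ^ n * (Y * (QQ ^ (n + 1))⁻¹) = 1 := by
      rw [pow_succ]
      field_simp
      rw [mul_comm, h3]
    linear_combination (1 - Y) * h2 + (1 - Y) * I * h4

theorem signTheta_add_one (hQ0 : Q ≠ 0) (n : ℤ) :
    algebraMap ZQSeries K (signTheta Q (n + 1)) =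
      -(algebraMap ZQSeries K (signTheta Q n) * algebraMap ZQSeries K Q ^ n) := by
  have hinj := IsFractionRing.injective ZQSeries K
  have hQK : algebraMap ZQSeries K Q ≠ 0 := by
    rwa [Ne, map_eq_zero_iff _ hinj]
  have h : algebraMap ZQSeries K Q ^ tri (n + 1) =
      algebraMap ZQSeries K Q ^ tri n * algebraMap ZQSeries K Q ^ n := by
    rw [← zpow_natCast, tri_add_one, zpow_add₀ hQK, zpow_natCast]
  simp only [signTheta, map_mul, map_pow, h, zpow_add_one, Units.val_mul, Units.val_neg,
    Units.val_one, map_neg, map_one]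
  ring

/-- Since signTheta(j+1) = -signTheta(j) Q^j, the two terms on the left combine to a multiple of (1
- yQ^(n-j)) kronTerm(n-j), which is 1 - y. Summed over j, the right side vanishes by
`tsum_signTheta`. -/
theorem signTheta_succ_mul_kronTerm (hy : y * y' = Q) (hy' : q ∣ y') (hQ0 : Q ≠ 0) (n : ℕ)
    (j : ℤ) :
    signTheta Q (j + 1) * kronTerm y y' Q (n - j) +
      y * Q ^ n * (signTheta Q j * kronTerm y y' Q (n - j)) = signTheta Q (j + 1) * (1 - y) := by
  have hinj := IsFractionRing.injective ZQSeries K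
  have hQK : algebraMap ZQSeries K Q ≠ 0 := by
    rwa [Ne, map_eq_zero_iff _ hinj]
  apply hinj
  have h1 := kronTerm_mul hy hy' hQ0 (n - j)
  have h2 := signTheta_add_one hQ0 j
  have h3 : algebraMap ZQSeries K Q ^ j * algebraMap ZQSeries K Q ^ ((n : ℤ) - j) =
      algebraMap ZQSeries K Q ^ n := by
    rw [← zpow_add₀ hQK, ← zpow_natCast]; congr 1; ring
  simp only [map_mul, map_add, map_sub, map_one, map_pow, h2]
  linear_combination (-algebraMap ZQSeries K (signTheta Q j) * algebraMap ZQSeries K Q ^ j) * h1 -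
    (algebraMap ZQSeries K (signTheta Q j) * algebraMap ZQSeries K (kronTerm y y' Q (n - j)) *
      algebraMap ZQSeries K y) * h3

/-- The same relation at negative index, multiplied by y'Q^m, the inverse of yQ^(-m-1), so that only
elements of the ring occur. -/
theorem signTheta_mul_kronTerm_neg (hy : y * y' = Q) (hy' : q ∣ y') (hQ0 : Q ≠ 0) (m : ℕ)
    (j : ℤ) :
    signTheta Q j * kronTerm y y' Q (-((m : ℤ) + 1) - j) +
      y' * Q ^ m * (signTheta Q (j + 1) * kronTerm y y' Q (-((m : ℤ) + 1) - j)) =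
      y' * Q ^ m * (signTheta Q (j + 1) * (1 - y)) := by
  have hinj := IsFractionRing.injective ZQSeries K
  have hQK : algebraMap ZQSeries K Q ≠ 0 := by
    rwa [Ne, map_eq_zero_iff _ hinj]
  apply hinj
  have h1 := kronTerm_mul hy hy' hQ0 (-((m : ℤ) + 1) - j)
  have h2 := signTheta_add_one hQ0 j
  have h3 : algebraMap ZQSeries K Q ^ j * algebraMap ZQSeries K Q ^ (-((m : ℤ) + 1) - j) *
      algebraMap ZQSeries K Q ^ (m + 1) = 1 := by
    rw [← zpow_add₀ hQK, ← zpow_natCast, ← zpow_add₀ hQK, ← zpow_zero (algebraMap ZQSeries K Q)]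
    congr 1; push_cast; ring
  have h4 := congr_arg (algebraMap ZQSeries K) hy
  rw [map_mul] at h4
  simp only [map_mul, map_add, map_sub, map_one, map_pow, h2]
  set Y := algebraMap ZQSeries K y
  set Y' := algebraMap ZQSeries K y'
  set QQ := algebraMap ZQSeries K Q
  set A := algebraMap ZQSeries K (kronTerm y y' Q (-((m : ℤ) + 1) - j))
  set T := algebraMap ZQSeries K (signTheta Q j)
  set P := QQ ^ (-((m : ℤ) + 1) - j)
  linear_combination (-T * QQ ^ j * Y' * QQ ^ m) * h1 - T * A * h3 -
    (T * A * QQ ^ j * QQ ^ m * P) * h4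

theorem locFin_signTheta_mul (hQ : q ∣ Q) (g : ℤ → ZQSeries) :
    LocFin fun j => signTheta Q j * g j := (locFin_signTheta hQ).mul_right g

theorem locFin_signTheta_succ_mul (hQ : q ∣ Q) (g : ℤ → ZQSeries) :
    LocFin fun j => signTheta Q (j + 1) * g j :=
  ((locFin_signTheta hQ).comp (add_left_injective 1)).mul_right g

theorem kronConv_add_one (n : ℤ) :
    kronConv y y' Q (n + 1) = ∑' j : ℤ, signTheta Q (j + 1) * kronTerm y y' Q (n - j) := by
  rw [kronConv, ← (Equiv.addRight (1 : ℤ)).tsum_eq]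
  refine tsum_congr fun j => ?_
  simp only [Equiv.coe_addRight]
  congr 2; ring

theorem tsum_signTheta_succ_mul (hQ : q ∣ Q) (c : ZQSeries) :
    ∑' j : ℤ, signTheta Q (j + 1) * c = 0 := by
  have := (Equiv.addRight (1 : ℤ)).tsum_eq fun j => signTheta Q j * c
  simp only [Equiv.coe_addRight] at this
  rw [this, (locFin_signTheta hQ).summable.tsum_mul_right, tsum_signTheta hQ, zero_mul]

theorem kronConv_succ (hy : y * y' = Q) (hy' : q ∣ y') (hQ0 : Q ≠ 0) (n : ℕ) :
    kronConv y y' Q (n + 1) = -(y * Q ^ n * kronConv y y' Q n) := by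
  have hQ : q ∣ Q := hy ▸ hy'.mul_left y
  rw [eq_neg_iff_add_eq_zero, kronConv_add_one, kronConv,
    ← (locFin_signTheta_mul hQ _).summable.tsum_mul_left,
    ← (locFin_signTheta_succ_mul hQ _).summable.tsum_add
      ((locFin_signTheta_mul hQ _).mul_left _).summable,
    tsum_congr fun j => signTheta_succ_mul_kronTerm hy hy' hQ0 n j, tsum_signTheta_succ_mul hQ]

theorem kronConv_neg_succ (hy : y * y' = Q) (hy' : q ∣ y') (hQ0 : Q ≠ 0) (m : ℕ) :
    kronConv y y' Q (-((m : ℤ) + 1)) = -(y' * Q ^ m * kronConv y y' Q (-(m : ℤ))) := by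
  have hQ : q ∣ Q := hy ▸ hy'.mul_left y
  rw [eq_neg_iff_add_eq_zero, show -(m : ℤ) = -((m : ℤ) + 1) + 1 by ring, kronConv_add_one,
    kronConv, ← (locFin_signTheta_succ_mul hQ _).summable.tsum_mul_left,
    ← (locFin_signTheta_mul hQ _).summable.tsum_add
      ((locFin_signTheta_succ_mul hQ _).mul_left _).summable,
    tsum_congr fun j => signTheta_mul_kronTerm_neg hy hy' hQ0 m j,
    (locFin_signTheta_succ_mul hQ _).summable.tsum_mul_left, tsum_signTheta_succ_mul hQ, mul_zero]

/-- The recursions in both directions are those of the theta coefficients (-y)^n Q^(n(n-1)/2), so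
only the value at 0 remains to be determined. -/
theorem kronConv_eq (hy : y * y' = Q) (hy' : q ∣ y') (hQ0 : Q ≠ 0) (n : ℤ) :
    kronConv y y' Q n = thetaTerm (-y) (-y') Q n * kronConv y y' Q 0 := by
  obtain ⟨k, rfl | rfl⟩ := n.eq_nat_or_neg
  · induction k with
    | zero => simp [thetaTerm]
    | succ k ih =>
      rw [thetaTerm_natCast] at *
      rw [Nat.cast_succ, kronConv_succ hy hy' hQ0, ih, choose_succ_two]
      ring
  · induction k with
    | zero => simp [thetaTerm]
    | succ k ih =>
      rw [thetaTerm_neg_natCast] at *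
      rw [Nat.cast_succ, kronConv_neg_succ hy hy' hQ0, ih, choose_succ_two]
      ring

theorem thetaTerm_mul_zpow (x : ZQSeriesˣ) (n : ℤ) :
    thetaTerm (-y) (-y') Q n * ((x ^ n : ZQSeriesˣ) : ZQSeries) =
      thetaTerm (-((x : ZQSeries) * y)) (-(((x⁻¹ : ZQSeriesˣ) : ZQSeries) * y')) Q n := by
  obtain ⟨k, rfl | rfl⟩ := n.eq_nat_or_neg
  · rw [thetaTerm_natCast, thetaTerm_natCast, neg_pow (_ * y), neg_pow y, zpow_natCast,
      Units.val_pow_eq_pow_val]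
    ring
  · rw [thetaTerm_neg_natCast, thetaTerm_neg_natCast, neg_pow (_ * y'), neg_pow y', zpow_neg,
      zpow_natCast, ← inv_pow, Units.val_pow_eq_pow_val]
    ring

theorem tsum_kronConv_mul_zpow (hy : y * y' = Q) (hy' : q ∣ y') (hQ0 : Q ≠ 0) (x : ZQSeriesˣ) :
    ∑' n, kronConv y y' Q n * ((x ^ n : ZQSeriesˣ) : ZQSeries) =
      kronConv y y' Q 0 * (eulerE Q * (qPoch ((x : ZQSeries) * y) Q *
        qPoch (((x⁻¹ : ZQSeriesˣ) : ZQSeries) * y') Q)) := by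
  have hQ : q ∣ Q := hy ▸ hy'.mul_left y
  have h := jacobi_triple_product (x := -((x : ZQSeries) * y))
    (x' := -(((x⁻¹ : ZQSeriesˣ) : ZQSeries) * y')) (Q := Q)
    (by rw [neg_mul_neg, mul_mul_mul_comm, Units.mul_inv, one_mul, hy])
    (dvd_neg.2 (hy'.mul_left _))
  rw [neg_neg, neg_neg] at h
  rw [h, ← (locFin_thetaTerm _ _ hQ).summable.tsum_mul_left]
  refine tsum_congr fun n => ?_
  rw [← thetaTerm_mul_zpow, kronConv_eq hy hy' hQ0]
  ring

theorem locFin_kronConv_mul (hy : y * y' = Q) (hy' : q ∣ y') (hQ0 : Q ≠ 0) (g : ℤ → ZQSeries) :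
    LocFin fun n => kronConv y y' Q n * g n := by
  have hQ : q ∣ Q := hy ▸ hy'.mul_left y
  refine (locFin_thetaTerm (-y) (-y') hQ).of_dvd fun n => ?_
  rw [kronConv_eq hy hy' hQ0, mul_assoc]
  exact dvd_mul_right _ _

/-! ### Lambert series -/

/-- `y Q^n / (1 - y Q^n)` for `n > 0`, and `1 / (1 - y Q^n)` for `n < 0`. -/
noncomputable def lambertTerm (y y' Q : ZQSeries) : ℤ → ZQSeries
  | Int.ofNat 0 => 0
  | Int.ofNat (n + 1) => y * Q ^ (n + 1) * Ring.inverse (1 - y * Q ^ (n + 1))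
  | Int.negSucc n => -(y' * Q ^ n * Ring.inverse (1 - y' * Q ^ n))

theorem locFin_lambertTerm (hQ : q ∣ Q) : LocFin (lambertTerm y y' Q) := by
  refine locFin_int 1 fun n => ?_
  rcases n with (_ | n) | n
  · simp [lambertTerm]
  · refine Dvd.dvd.mul_right (Dvd.dvd.mul_left ?_ _) _
    exact (pow_dvd_pow_of_dvd hQ _).trans (pow_dvd_pow Q (Nat.sub_le _ _))
  · refine dvd_neg.2 (Dvd.dvd.mul_right (Dvd.dvd.mul_left ?_ _) _)
    exact (pow_dvd_pow_of_dvd hQ _).trans (pow_dvd_pow Q (by simp))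

/-- `kronTerm` is (1 - y) `lambertTerm` plus the step function [n ≥ 0] - y[n > 0]; differencing
turns the steps into point masses at 0 and 1. -/
theorem kronTerm_sub (hQ : q ∣ Q) (n : ℤ) :
    kronTerm y y' Q n - kronTerm y y' Q (n - 1) =
      (1 - y) * (lambertTerm y y' Q n - lambertTerm y y' Q (n - 1)) +
        ((if n = 0 then 1 else 0) - if n = 1 then y else 0) := by
  have h1 : ∀ n : ℤ, kronTerm y y' Q n = (1 - y) * lambertTerm y y' Q n +
      ((if 0 ≤ n then 1 else 0) - if 0 < n then y else 0) := by
    rintro ((_ | n) | n)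
    · simp [kronTerm, lambertTerm]
    · have h0 : (0 : ℤ) < ((n : ℤ) + 1) := by omega
      have h : (1 - y * Q ^ (n + 1)) * Ring.inverse (1 - y * Q ^ (n + 1)) = 1 :=
        mul_inverse (isUnit_one_sub ((hQ.trans (dvd_pow_self Q n.succ_ne_zero)).mul_left y))
      simp [kronTerm, lambertTerm, h0, h0.le]
      linear_combination (1 - y) * h
    · have h0 : ¬ (0 : ℤ) ≤ Int.negSucc n := by simp
      have h0' : ¬ (0 : ℤ) < Int.negSucc n := by simp
      simp [kronTerm, lambertTerm, h0, h0']
  rw [h1, h1]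
  rcases lt_trichotomy n 0 with h | rfl | h
  · rw [if_neg (by omega), if_neg (by omega), if_neg (by omega), if_neg (by omega),
      if_neg (by omega), if_neg (by omega)]
    ring
  · simp; ring
  · rcases eq_or_ne n 1 with rfl | h'
    · simp; ring
    · rw [if_pos (by omega), if_pos (by omega), if_pos (by omega), if_pos (by omega),
        if_neg (by omega), if_neg (by omega)]
      ring

theorem locFin_kronTerm_sub (hQ : q ∣ Q) :
    LocFin fun n => kronTerm y y' Q n - kronTerm y y' Q (n - 1) := by
  simp_rw [kronTerm_sub hQ]
  refine LocFin.add (((locFin_lambertTerm hQ).sub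
    ((locFin_lambertTerm hQ).comp (sub_left_injective))).mul_left _) fun n => ?_
  refine (Set.toFinite {0, 1}).subset fun i hi => ?_
  by_contra h
  simp only [Set.mem_insert_iff, Set.mem_singleton_iff, not_or] at h
  apply hi
  simp [h.1, h.2]

theorem tsum_kronTerm_sub_mul_zpow (hQ : q ∣ Q) (x : ZQSeriesˣ) :
    ∑' n : ℤ, (kronTerm y y' Q n - kronTerm y y' Q (n - 1)) * ((x ^ n : ZQSeriesˣ) : ZQSeries) =
      1 - x * y + (1 - x) * (1 - y) *
        ∑' n : ℤ, lambertTerm y y' Q n * ((x ^ n : ZQSeriesˣ) : ZQSeries) := by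
  have hl : LocFin fun n => lambertTerm y y' Q n * ((x ^ n : ZQSeriesˣ) : ZQSeries) :=
    (locFin_lambertTerm hQ).mul_right _
  have hl' : LocFin fun n => lambertTerm y y' Q (n - 1) * ((x ^ n : ZQSeriesˣ) : ZQSeries) :=
    ((locFin_lambertTerm hQ).comp (sub_left_injective)).mul_right _
  have e1 : ∑' n : ℤ, lambertTerm y y' Q (n - 1) * ((x ^ n : ZQSeriesˣ) : ZQSeries) =
      x * ∑' n : ℤ, lambertTerm y y' Q n * ((x ^ n : ZQSeriesˣ) : ZQSeries) := by
    rw [← (Equiv.addRight (1 : ℤ)).tsum_eq, ← hl.summable.tsum_mul_left]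
    refine tsum_congr fun n => ?_
    simp only [Equiv.coe_addRight, add_sub_cancel_right, zpow_add_one, Units.val_mul]
    ring
  have e2 : ∀ (k : ℤ) (c : ZQSeries), HasSum (fun n : ℤ => if n = k then c else 0) c :=
    fun k c => hasSum_ite_eq k c
  have e3 : ∀ n : ℤ, (kronTerm y y' Q n - kronTerm y y' Q (n - 1)) *
      ((x ^ n : ZQSeriesˣ) : ZQSeries) =
      (1 - y) * (lambertTerm y y' Q n * ((x ^ n : ZQSeriesˣ) : ZQSeries) -
        lambertTerm y y' Q (n - 1) * ((x ^ n : ZQSeriesˣ) : ZQSeries)) +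
      ((if n = 0 then 1 else 0) - if n = 1 then (x : ZQSeries) * y else 0) := by
    intro n
    rw [kronTerm_sub hQ]
    split_ifs with h h'
    · omega
    · subst h; simp
    · rename_i h'; subst h'; simp; ring
    · ring
  rw [tsum_congr e3, (((hl.summable.hasSum.sub hl'.summable.hasSum).mul_left (1 - y)).add
    ((e2 0 1).sub (e2 1 _))).tsum_eq, e1]
  ring

/-- The equivalence `(n, j) ↦ (j, n - j)`. -/
def convolutionEquiv : ℤ × ℤ ≃ ℤ × ℤ where
  toFun p := (p.2, p.1 - p.2)
  invFun p := (p.1 + p.2, p.1)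
  left_inv p := by simp
  right_inv p := by simp

/-- `kronTerm` tends to 1 - y as n → +∞, so its generating series in x need not converge.
Differencing, that is multiplication by 1 - x, restores local finiteness, and the Cauchy product
then gives differences of `kronConv`. -/
theorem tsum_signTheta_mul_tsum_kronTerm (hy : y * y' = Q) (hy' : q ∣ y') (hQ0 : Q ≠ 0)
    (x : ZQSeriesˣ) :
    (∑' n, signTheta Q n * ((x ^ n : ZQSeriesˣ) : ZQSeries)) *
      (∑' n : ℤ, (kronTerm y y' Q n - kronTerm y y' Q (n - 1)) *
        ((x ^ n : ZQSeriesˣ) : ZQSeries)) =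
      (1 - x) * ∑' n, kronConv y y' Q n * ((x ^ n : ZQSeriesˣ) : ZQSeries) := by
  have hQ : q ∣ Q := hy ▸ hy'.mul_left y
  have h1 := locFin_signTheta_mul hQ fun n => ((x ^ n : ZQSeriesˣ) : ZQSeries)
  have h2 : LocFin fun n : ℤ => (kronTerm y y' Q n - kronTerm y y' Q (n - 1)) *
        ((x ^ n : ZQSeriesˣ) : ZQSeries) := (locFin_kronTerm_sub hQ).mul_right _
  have h3 := (h1.prod h2).comp convolutionEquiv.injective
  have h4 := locFin_kronConv_mul hy hy' hQ0 fun n => ((x ^ n : ZQSeriesˣ) : ZQSeries)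
  have h5 : ∑' n : ℤ, kronConv y y' Q (n - 1) * ((x ^ n : ZQSeriesˣ) : ZQSeries) =
      x * ∑' n, kronConv y y' Q n * ((x ^ n : ZQSeriesˣ) : ZQSeries) := by
    rw [← (Equiv.addRight (1 : ℤ)).tsum_eq, ← h4.summable.tsum_mul_left]
    refine tsum_congr fun n => ?_
    simp only [Equiv.coe_addRight, add_sub_cancel_right, zpow_add_one, Units.val_mul]
    ring
  have h6 : LocFin fun n : ℤ => kronConv y y' Q (n - 1) * ((x ^ n : ZQSeriesˣ) : ZQSeries) := by
    refine (h4.comp (sub_left_injective (b := (1 : ℤ)))).of_dvd fun n => ?_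
    rw [zpow_sub_one, Units.val_mul, ← mul_assoc]
    exact ((Units.isUnit _).dvd_mul_right).1 dvd_rfl
  rw [h1.tsum_mul_tsum h2, ← convolutionEquiv.tsum_eq, h3.tsum_prod, sub_mul, one_mul, ← h5,
    ← h4.summable.tsum_sub h6.summable]
  refine tsum_congr fun n => ?_
  simp only [convolutionEquiv, Equiv.coe_fn_mk]
  rw [kronConv, kronConv, ← sub_mul, ← (locFin_signTheta_mul hQ _).summable.tsum_sub
    (locFin_signTheta_mul hQ _).summable,
    ← ((locFin_signTheta_mul hQ _).sub (locFin_signTheta_mul hQ _)).summable.tsum_mul_right]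
  refine tsum_congr fun j => ?_
  have : ((x ^ n : ZQSeriesˣ) : ZQSeries) = (x ^ j : ZQSeriesˣ) * (x ^ (n - j) : ZQSeriesˣ) := by
    rw [← Units.val_mul, ← zpow_add, add_sub_cancel]
  rw [this, sub_right_comm n 1 j]
  ring

end

end QSeries

/-! ### Kronecker's formula: evaluation of the constant and the double series -/

namespace QSeries

section

variable {y y' Q : ZQSeries}

theorem inverse_one_sub_mul_pow {y Q : ZQSeries} {n : ℕ} (h : q ∣ y * Q ^ n) :
    Ring.inverse (1 - y * Q ^ n) = ∑' m : ℕ, y ^ m * Q ^ (n * m) := by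
  rw [inverse_one_sub h]
  exact tsum_congr fun m => by rw [mul_pow, pow_mul]

theorem kronConv_zero (hQ : q ∣ Q) :
    kronConv y y' Q 0 = 1 +
      ∑' j : ℕ, (-1) ^ (j + 1) * Q ^ (j + 2).choose 2 *
        ((1 - y) * Ring.inverse (1 - y * Q ^ (j + 1))) +
      ∑' j : ℕ, (-1) ^ j * Q ^ (j + 1).choose 2 *
        ((1 - y) * (y' * Q ^ j * Ring.inverse (1 - y' * Q ^ j))) := by
  have h1 := locFin_signTheta_mul hQ fun j => kronTerm y y' Q (0 - j)
  have h2 := h1.comp (Equiv.neg ℤ).injective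
  rw [kronConv, ← (Equiv.neg ℤ).tsum_eq, h2.tsum_int,
    (h2.comp (e := fun n : ℕ => (n : ℤ)) Nat.cast_injective).tsum_eq_zero_add]
  simp only [Equiv.neg_apply, sub_neg_eq_add, zero_add, neg_neg]
  have hk : ∀ j : ℕ, kronTerm y y' Q ((j + 1 : ℕ) : ℤ) =
      (1 - y) * Ring.inverse (1 - y * Q ^ (j + 1)) := fun j => rfl
  have hk' : ∀ j : ℕ, kronTerm y y' Q (-((j : ℤ) + 1)) =
      -((1 - y) * (y' * Q ^ j * Ring.inverse (1 - y' * Q ^ j))) := fun j => by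
    rw [← Int.negSucc_eq]; rfl
  refine congrArg₂ (· + ·) (congrArg₂ (· + ·) ?_ (tsum_congr fun j => ?_))
    (tsum_congr fun j => ?_)
  · have : kronTerm y y' Q ((0 : ℕ) : ℤ) = 1 := rfl
    rw [signTheta_neg_natCast, this]
    simp
  · rw [signTheta_neg_natCast, hk]
  · rw [zero_sub, hk', ← Nat.cast_succ, signTheta_natCast, Nat.succ_eq_add_one]
    ring

theorem locFin_pow_mul_pow_mul (hQ : q ∣ Q) (hy : q ∣ y) (g : ℕ × ℕ → ZQSeries) :
    LocFin fun p : ℕ × ℕ => Q ^ p.1 * y ^ p.2 * g p :=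
  (locFin_nat_prod (f := fun p : ℕ × ℕ => Q ^ p.1 * y ^ p.2) fun p => by
    rw [pow_add]
    exact mul_dvd_mul (pow_dvd_pow_of_dvd hQ _) (pow_dvd_pow_of_dvd hy _)).mul_right g

theorem locFin_pow_succ_mul_partialTheta (hQ : q ∣ Q) :
    LocFin fun m : ℕ => y ^ m * (Q ^ (m + 1) * partialTheta Q (m + 1)) :=
  (((locFin_pow_mul hQ fun m => Q * partialTheta Q (m + 1))).mul_left fun m => y ^ m).of_dvd
    fun m => by rw [pow_succ, mul_assoc]

theorem locFin_pow_mul_partialTheta (hy' : q ∣ y') :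
    LocFin fun m : ℕ => y' ^ (m + 1) * partialTheta Q (m + 1) :=
  ((locFin_pow hy').comp (add_left_injective 1)).mul_right _

/-- Expand each denominator as a geometric series and sum over the theta index first: the inner sums
are partial theta series, in the y-part after `partialTheta_rec`. -/
theorem kronConv_zero_eq (hy : y * y' = Q) (hy' : q ∣ y') :
    kronConv y y' Q 0 = 1 - (1 - y) * ∑' m : ℕ, y ^ m * (Q ^ (m + 1) * partialTheta Q (m + 1)) +
      (1 - y) * ∑' m : ℕ, y' ^ (m + 1) * partialTheta Q (m + 1) := by
  have hQ : q ∣ Q := hy ▸ hy'.mul_left y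
  have e1 : ∑' j : ℕ, (-1) ^ (j + 1) * Q ^ (j + 2).choose 2 *
        ((1 - y) * Ring.inverse (1 - y * Q ^ (j + 1))) =
      -((1 - y) * ∑' m : ℕ, y ^ m * (Q ^ (m + 1) * partialTheta Q (m + 1))) := by
    have hlf : LocFin fun p : ℕ × ℕ => (-1) ^ (p.1 + 1) * Q ^ (p.1 + 2).choose 2 *
        ((1 - y) * (y ^ p.2 * Q ^ ((p.1 + 1) * p.2))) := by
      refine (locFin_pow_mul_pow_mul hQ hQ fun p => 1).of_dvd fun p => ?_
      rw [mul_one, ← pow_add]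
      refine (pow_dvd_pow Q ?_).trans (b := Q ^ ((p.1 + 2).choose 2 + (p.1 + 1) * p.2)) ?_
      · rw [choose_succ_two (p.1 + 1)]; nlinarith [p.1.zero_le, p.2.zero_le]
      · rw [pow_add]
        exact ⟨(-1) ^ (p.1 + 1) * (1 - y) * y ^ p.2, by ring⟩
    have h1 : ∀ j : ℕ, (-1) ^ (j + 1) * Q ^ (j + 2).choose 2 *
        ((1 - y) * Ring.inverse (1 - y * Q ^ (j + 1))) =
        ∑' m : ℕ, (-1) ^ (j + 1) * Q ^ (j + 2).choose 2 *
        ((1 - y) * (y ^ m * Q ^ ((j + 1) * m))) := by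
      intro j
      have hj : q ∣ Q ^ (j + 1) := hQ.trans (dvd_pow_self Q j.succ_ne_zero)
      have hg : LocFin fun m : ℕ => y ^ m * Q ^ ((j + 1) * m) :=
        ((locFin_pow hj).mul_left fun m => y ^ m).of_dvd fun m => by rw [pow_mul]
      rw [inverse_one_sub_mul_pow (hj.mul_left y), ← hg.summable.tsum_mul_left,
        ← (hg.mul_left _).summable.tsum_mul_left]
    rw [tsum_congr h1, hlf.tsum_comm, ← (locFin_pow_succ_mul_partialTheta hQ).summable.tsum_mul_left,
      ← tsum_neg]
    refine tsum_congr fun m => ?_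
    have h2 := partialTheta_rec hQ m
    rw [partialTheta_sub_one hQ] at h2
    have h3 : LocFin fun j : ℕ => Q ^ (j + 2).choose 2 * ((-1) ^ (j + 1) * Q ^ ((j + 1) * m)) :=
      (locFin_pow_choose_succ_mul hQ fun j => (-1) ^ j * Q ^ (j * m)).comp (add_left_injective 1)
    rw [show -((1 - y) * (y ^ m * (Q ^ (m + 1) * partialTheta Q (m + 1)))) =
      (1 - y) * y ^ m * -(Q ^ (m + 1) * partialTheta Q (m + 1)) by ring, ← h2,
      ← h3.summable.tsum_mul_left]
    exact tsum_congr fun j => by ring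
  have e2 : ∑' j : ℕ, (-1) ^ j * Q ^ (j + 1).choose 2 *
        ((1 - y) * (y' * Q ^ j * Ring.inverse (1 - y' * Q ^ j))) =
      (1 - y) * ∑' m : ℕ, y' ^ (m + 1) * partialTheta Q (m + 1) := by
    have hlf : LocFin fun p : ℕ × ℕ => (-1) ^ p.1 * Q ^ (p.1 + 1).choose 2 *
        ((1 - y) * (y' * Q ^ p.1 * (y' ^ p.2 * Q ^ (p.1 * p.2)))) := by
      refine (locFin_pow_mul_pow_mul hQ hy' fun p => 1).of_dvd fun p => ?_
      exact ⟨(-1) ^ p.1 * Q ^ (p.1 + 1).choose 2 * ((1 - y) * (y' * Q ^ (p.1 * p.2))), by ring⟩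
    have h1 : ∀ j : ℕ, (-1) ^ j * Q ^ (j + 1).choose 2 *
        ((1 - y) * (y' * Q ^ j * Ring.inverse (1 - y' * Q ^ j))) =
        ∑' m : ℕ, (-1) ^ j * Q ^ (j + 1).choose 2 *
        ((1 - y) * (y' * Q ^ j * (y' ^ m * Q ^ (j * m)))) := by
      intro j
      have hg : LocFin fun m : ℕ => y' ^ m * Q ^ (j * m) := (locFin_pow hy').mul_right _
      rw [inverse_one_sub_mul_pow (hy'.mul_right _), ← hg.summable.tsum_mul_left,
        ← (hg.mul_left _).summable.tsum_mul_left, ← ((hg.mul_left _).mul_left _).summable.tsum_mul_left]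
    rw [tsum_congr h1, hlf.tsum_comm, ← (locFin_pow_mul_partialTheta hy').summable.tsum_mul_left]
    refine tsum_congr fun m => ?_
    rw [partialTheta, ← (locFin_pow_choose_succ_mul hQ _).summable.tsum_mul_left,
      ← ((locFin_pow_choose_succ_mul hQ _).mul_left _).summable.tsum_mul_left]
    exact tsum_congr fun j => by ring
  rw [kronConv_zero hQ, e1, e2]
  ring

/-- The partial fraction expansion of `1 / ((y;Q)_∞ (Q/y;Q)_∞)`. -/
theorem eulerE_sq_eq (hy : y * y' = Q) (hy' : q ∣ y') :
    eulerE Q ^ 2 = qPoch (y * Q) Q * qPoch y' Q * kronConv y y' Q 0 := by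
  have hQ : q ∣ Q := hy ▸ hy'.mul_left y
  have hA := locFin_pow_succ_mul_partialTheta (y := y) hQ
  have hB := locFin_pow_mul_partialTheta (Q := Q) hy'
  have hκ : ∀ m, eulerE Q ^ 2 * crankSum Q m =
      partialTheta Q m - Q * partialTheta Q (m + 1) := eulerE_sq_mul_crankSum hQ
  have hC : LocFin fun m : ℕ => (y * Q) ^ m * (partialTheta Q m - Q * partialTheta Q (m + 1)) :=
    (locFin_pow (hQ.mul_left y)).mul_right _
  have hD : LocFin fun m : ℕ => y' ^ (m + 1) *
      (partialTheta Q (m + 1) - Q * partialTheta Q (m + 2)) :=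
    ((locFin_pow hy').comp (add_left_injective 1)).mul_right _
  have h1 : eulerE Q ^ 2 * (Ring.inverse (qPoch (y * Q) Q) * Ring.inverse (qPoch y' Q)) =
      ∑' m : ℕ, (y * Q) ^ m * (partialTheta Q m - Q * partialTheta Q (m + 1)) +
      ∑' m : ℕ, y' ^ (m + 1) * (partialTheta Q (m + 1) - Q * partialTheta Q (m + 2)) := by
    rw [inverse_qPoch_mul_inverse_qPoch hy hy', mul_add,
      ← ((locFin_pow (hQ.mul_left y)).mul_right _).summable.tsum_mul_left,
      ← (((locFin_pow hy').comp (add_left_injective 1)).mul_right _).summable.tsum_mul_left]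
    exact congrArg₂ (· + ·) (tsum_congr fun m => by rw [← hκ]; ring)
      (tsum_congr fun m => by rw [← hκ]; ring)
  -- Multiplication by 1 - y matches coefficients with the crank sums: y y' = Q lowers the power of
  -- y' by one and creates the factor Q. The boundary term Q `partialTheta Q 1` cancels against the
  -- one in h3.
  have h2 : (1 - y) * ∑' m : ℕ, y' ^ (m + 1) * partialTheta Q (m + 1) =
      ∑' m : ℕ, y' ^ (m + 1) * (partialTheta Q (m + 1) - Q * partialTheta Q (m + 2)) -
        Q * partialTheta Q 1 := by
    have hB' : LocFin fun m : ℕ => y' ^ m * (Q * partialTheta Q (m + 1)) :=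
      (locFin_pow hy').mul_right _
    have e1 : y * ∑' m : ℕ, y' ^ (m + 1) * partialTheta Q (m + 1) =
        ∑' m : ℕ, y' ^ m * (Q * partialTheta Q (m + 1)) := by
      rw [← hB.summable.tsum_mul_left]
      refine tsum_congr fun m => ?_
      rw [← hy]; ring
    have e2 := hB'.tsum_eq_zero_add
    have e3 : ∑' m : ℕ, y' ^ (m + 1) * (partialTheta Q (m + 1) - Q * partialTheta Q (m + 2)) =
        ∑' m : ℕ, y' ^ (m + 1) * partialTheta Q (m + 1) -
        ∑' m : ℕ, y' ^ (m + 1) * (Q * partialTheta Q (m + 2)) := by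
      rw [← hB.summable.tsum_sub (hB'.comp (add_left_injective 1)).summable]
      exact tsum_congr fun m => by ring
    rw [pow_zero, one_mul, zero_add] at e2
    rw [e3]
    linear_combination -e1 - e2
  have h3 : (1 - y) * ∑' m : ℕ, y ^ m * (Q ^ (m + 1) * partialTheta Q (m + 1)) =
      1 - Q * partialTheta Q 1 -
      ∑' m : ℕ, (y * Q) ^ m * (partialTheta Q m - Q * partialTheta Q (m + 1)) := by
    have e1 := hC.tsum_eq_zero_add
    have e2 := hA.tsum_eq_zero_add
    have e3 : ∑' m : ℕ, (y * Q) ^ (m + 1) *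
        (partialTheta Q (m + 1) - Q * partialTheta Q (m + 1 + 1)) =
        ∑' m : ℕ, y ^ (m + 1) * (Q ^ (m + 1 + 1) * partialTheta Q (m + 1 + 1)) * (-1) +
        ∑' m : ℕ, y * (y ^ m * (Q ^ (m + 1) * partialTheta Q (m + 1))) := by
      have hA' := (hA.comp (add_left_injective 1)).mul_right fun _ => -1
      rw [← hA'.summable.tsum_add (hA.mul_left _).summable]
      exact tsum_congr fun m => by ring
    rw [(hA.comp (add_left_injective 1)).summable.tsum_mul_right, hA.summable.tsum_mul_left] at e3
    have e4 := partialTheta_rec hQ 0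
    simp only [pow_zero, one_mul, zero_add, pow_one] at e1 e2 e4
    rw [e1, e3]
    linear_combination e2 + e4
  have h4 : eulerE Q ^ 2 * (Ring.inverse (qPoch (y * Q) Q) * Ring.inverse (qPoch y' Q)) =
      kronConv y y' Q 0 := by
    rw [kronConv_zero_eq hy hy', h1]
    linear_combination h3 - h2
  have h5 := mul_inverse (isUnit_qPoch hQ (hQ.mul_left y))
  have h6 := mul_inverse (isUnit_qPoch hQ hy')
  rw [← h4]
  linear_combination (-eulerE Q ^ 2) * h5 - (eulerE Q ^ 2) *
    (qPoch (y * Q) Q * Ring.inverse (qPoch (y * Q) Q)) * h6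

/-- Kronecker's formula for a quotient of theta functions. -/
theorem eulerE_sq_mul_qPoch (hy : y * y' = Q) (hy' : q ∣ y') (hQ0 : Q ≠ 0) (x : ZQSeriesˣ)
    (hx : (x : ZQSeries) ≠ 1) :
    eulerE Q ^ 2 * (qPoch (x * y : ZQSeries) Q * qPoch (((x⁻¹ : ZQSeriesˣ) : ZQSeries) * y') Q) =
      qPoch (x * Q : ZQSeries) Q * qPoch (((x⁻¹ : ZQSeriesˣ) : ZQSeries) * Q) Q *
        (qPoch (y * Q) Q * qPoch y' Q) *
        (1 - x * y + (1 - x) * (1 - y) *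
          ∑' n : ℤ, lambertTerm y y' Q n * ((x ^ n : ZQSeriesˣ) : ZQSeries)) := by
  have hQ : q ∣ Q := hy ▸ hy'.mul_left y
  have h1 := tsum_signTheta_mul_tsum_kronTerm hy hy' hQ0 x
  rw [tsum_signTheta_mul_zpow x hQ, tsum_kronConv_mul_zpow hy hy' hQ0,
    tsum_kronTerm_sub_mul_zpow hQ, qPoch_eq_mul (x : ZQSeries) hQ] at h1
  -- Both sides of h1 carry E(Q)(1 - x): on the left through the theta function of x, on the right
  -- through the Jacobi product and the differencing.
  have h2 : eulerE Q * (1 - (x : ZQSeries)) ≠ 0 :=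
    mul_ne_zero (isUnit_eulerE hQ).ne_zero (sub_ne_zero.2 hx.symm)
  apply mul_left_cancel₀ h2
  rw [eulerE_sq_eq hy hy']
  linear_combination (-(qPoch (y * Q) Q * qPoch y' Q)) * h1

/-- The Lambert series in Kronecker's formula as a double series. -/
theorem tsum_lambertTerm_mul_zpow (hy' : q ∣ y') (hQ : q ∣ Q) (x : ZQSeriesˣ) :
    ∑' n : ℤ, lambertTerm y y' Q n * ((x ^ n : ZQSeriesˣ) : ZQSeries) =
      ∑' p : ℕ × ℕ, (x : ZQSeries) ^ (p.1 + 1) * (y ^ (p.2 + 1) * Q ^ ((p.1 + 1) * (p.2 + 1))) -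
      ∑' p : ℕ × ℕ, ((x⁻¹ : ZQSeriesˣ) : ZQSeries) ^ (p.1 + 1) *
        (y' ^ (p.2 + 1) * Q ^ (p.1 * (p.2 + 1))) := by
  have h1 : LocFin fun n => lambertTerm y y' Q n * ((x ^ n : ZQSeriesˣ) : ZQSeries) :=
    (locFin_lambertTerm hQ).mul_right _
  have h2 : LocFin fun p : ℕ × ℕ =>
      (x : ZQSeries) ^ (p.1 + 1) * (y ^ (p.2 + 1) * Q ^ ((p.1 + 1) * (p.2 + 1))) := by
    refine (locFin_pow_mul_pow_mul hQ hQ fun p => 1).of_dvd fun p => ?_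
    rw [mul_one, ← pow_add]
    exact ((pow_dvd_pow Q (by nlinarith [p.1.zero_le, p.2.zero_le])).mul_left _).mul_left _
  have h3 : LocFin fun p : ℕ × ℕ => ((x⁻¹ : ZQSeriesˣ) : ZQSeries) ^ (p.1 + 1) *
        (y' ^ (p.2 + 1) * Q ^ (p.1 * (p.2 + 1))) := by
    refine (locFin_pow_mul_pow_mul hQ hy' fun p => 1).of_dvd fun p => ?_
    exact ⟨((x⁻¹ : ZQSeriesˣ) : ZQSeries) ^ (p.1 + 1) * (y' * Q ^ (p.1 * p.2)), by ring⟩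
  rw [h1.tsum_int, (h1.comp (e := fun n : ℕ => (n : ℤ)) Nat.cast_injective).tsum_eq_zero_add,
    sub_eq_add_neg, ← tsum_neg, h2.tsum_prod, h3.neg.tsum_prod]
  have h0 : lambertTerm y y' Q ((0 : ℕ) : ℤ) = 0 := rfl
  rw [h0, zero_mul, zero_add]
  refine congrArg₂ (· + ·) (tsum_congr fun n => ?_) (tsum_congr fun n => ?_)
  · have hn : q ∣ Q ^ (n + 1) := hQ.trans (dvd_pow_self Q n.succ_ne_zero)
    have hg : LocFin fun m : ℕ => y ^ m * Q ^ ((n + 1) * m) :=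
      ((locFin_pow hn).mul_left fun m => y ^ m).of_dvd fun m => by rw [pow_mul]
    have h4 : lambertTerm y y' Q ((n + 1 : ℕ) : ℤ) =
      y * Q ^ (n + 1) * Ring.inverse (1 - y * Q ^ (n + 1)) := rfl
    rw [h4, inverse_one_sub_mul_pow (hn.mul_left y), ← hg.summable.tsum_mul_left,
      ← (hg.mul_left _).summable.tsum_mul_right, zpow_natCast, Units.val_pow_eq_pow_val]
    exact tsum_congr fun m => by ring
  · have hg : LocFin fun m : ℕ => y' ^ m * Q ^ (n * m) := (locFin_pow hy').mul_right _
    have h4 : lambertTerm y y' Q (-((n : ℤ) + 1)) =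
      -(y' * Q ^ n * Ring.inverse (1 - y' * Q ^ n)) := by
      rw [← Int.negSucc_eq]; rfl
    rw [h4, inverse_one_sub_mul_pow (hy'.mul_right _), ← hg.summable.tsum_mul_left, ← tsum_neg,
      ← (hg.mul_left _).neg.summable.tsum_mul_right, ← Nat.cast_succ, zpow_neg, zpow_natCast,
      Nat.succ_eq_add_one, ← inv_pow, Units.val_pow_eq_pow_val]
    exact tsum_congr fun m => by ring

end

end QSeries

namespace QSeries

/-! ### Dissection of the theta quotient according to powers of `z` modulo `t` -/

theorem q_ne_zero : q ≠ 0 := PowerSeries.X_ne_zero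

theorem val_z_zpow (n : ℤ) :
    ((z ^ n : ZQSeriesˣ) : ZQSeries) = PowerSeries.C (LaurentPolynomial.T n) := by
  have h : ∀ n : ℕ, ((z ^ n : ZQSeriesˣ) : ZQSeries) = PowerSeries.C (LaurentPolynomial.T n) := by
    intro n
    have hz : (z : ZQSeries) = PowerSeries.C (LaurentPolynomial.T 1) := rfl
    rw [Units.val_pow_eq_pow_val, hz, ← map_pow, LaurentPolynomial.T_pow, mul_one]
  obtain ⟨k, rfl | rfl⟩ := n.eq_nat_or_neg
  · rw [zpow_natCast, h]
  · apply (Units.isUnit (z ^ k)).mul_left_cancel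
    rw [zpow_neg, zpow_natCast, Units.mul_inv, h, ← map_mul, ← LaurentPolynomial.T_add]
    simp

theorem z_pow_ne_one {n : ℤ} (hn : n ≠ 0) : ((z ^ n : ZQSeriesˣ) : ZQSeries) ≠ 1 := by
  intro hz
  rw [val_z_zpow, ← map_one PowerSeries.C, PowerSeries.C_injective.eq_iff,
    ← LaurentPolynomial.T_zero] at hz
  have := congr_arg (fun p : LaurentPolynomial ℤ => p.coeff 0) hz
  simp only [LaurentPolynomial.T_apply, if_neg hn, if_true] at this
  exact zero_ne_one this

/-- The terms `z^(N-tM) q^(NM)` with `M = m + 1`. -/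
noncomputable def lambertMonomial (s : ℤ) (t N m : ℕ) : ZQSeries :=
  ((z ^ (s * ((N : ℤ) - t * (m + 1))) : ZQSeriesˣ) : ZQSeries) * q ^ (N * (m + 1))

theorem locFin_lambertMonomial (s : ℤ) (t : ℕ) :
    LocFin fun p : ℕ × ℕ => lambertMonomial s t (p.1 + 1) p.2 :=
  locFin_nat_prod fun p => (pow_dvd_pow q (by nlinarith [p.1.zero_le, p.2.zero_le])).mul_left _

theorem tsum_eq_sum_residues {f : ℕ × ℕ → ZQSeries} (hf : LocFin f) {t : ℕ} (ht : 0 < t) :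
    ∑' p, f p = ∑ i ∈ Finset.range t, ∑' p : ℕ × ℕ, f (t * p.1 + i, p.2) := by
  have : NeZero t := ⟨ht.ne'⟩
  have hinj : ∀ i, Function.Injective fun p : ℕ × ℕ => (t * p.1 + i, p.2) := by
    rintro i ⟨a, b⟩ ⟨c, d⟩ h
    simp only [Prod.mk.injEq, add_left_inj, mul_eq_mul_left_iff, ht.ne', or_false] at h
    rw [h.1, h.2]
  rw [hf.tsum_prod, ← (Nat.divModEquiv t).symm.tsum_eq]
  have h := hf.tsum_fiber.comp (Nat.divModEquiv t).symm.injective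
  rw [h.tsum_prod]
  simp_rw [tsum_fintype]
  rw [Summable.tsum_finsetSum fun i _ => (h.comp (Prod.mk_left_injective i)).summable,
    ← Fin.sum_univ_eq_sum_range fun i => ∑' p : ℕ × ℕ, f (t * p.1 + i, p.2)]
  refine Finset.sum_congr rfl fun i _ => ?_
  rw [(hf.comp (hinj i)).tsum_prod]
  refine tsum_congr fun n => tsum_congr fun m => ?_
  simp [Nat.divModEquiv, mul_comm]

/-- For N = t(n+1), exchanging n and m negates the exponent of z and preserves that of q. -/
theorem tsum_lambertMonomial_multiple (t : ℕ) (s : ℤ) :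
    ∑' p : ℕ × ℕ, lambertMonomial s t (t * p.1 + t) p.2 =
      ∑' p : ℕ × ℕ, lambertMonomial (-s) t (t * p.1 + t) p.2 := by
  rw [← (Equiv.prodComm ℕ ℕ).tsum_eq]
  refine tsum_congr fun p => ?_
  simp only [Equiv.prodComm_apply, Prod.fst_swap, Prod.snd_swap, lambertMonomial]
  have h : s * (((t * p.2 + t : ℕ) : ℤ) - t * (p.1 + 1)) =
      -s * (((t * p.1 + t : ℕ) : ℤ) - t * (p.2 + 1)) := by push_cast; ring
  rw [h, show (t * p.2 + t) * (p.1 + 1) = (t * p.1 + t) * (p.2 + 1) by ring]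

/-- The sum over one residue class. -/
noncomputable def residueSum (s : ℤ) (t r : ℕ) : ZQSeries :=
  ∑' p : ℕ × ℕ, lambertMonomial s t (t * p.1 + r) p.2

/-- Residue i+1 with sign + and residue a-i with sign - both have z-exponents congruent to i+1
modulo a+1, which is why they are grouped together. -/
theorem tsum_lambertMonomial_sub (a : ℕ) :
    ∑' p : ℕ × ℕ, lambertMonomial (-1) (a + 1) (p.1 + 1) p.2 -
      ∑' p : ℕ × ℕ, lambertMonomial 1 (a + 1) (p.1 + 1) p.2 =
    -∑ i ∈ Finset.range a,
      (residueSum 1 (a + 1) (i + 1) - residueSum (-1) (a + 1) (a - i)) := by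
  have h1 := fun s => tsum_eq_sum_residues (locFin_lambertMonomial s (a + 1)) a.succ_pos
  have h2 := tsum_lambertMonomial_multiple (a + 1) 1
  have h3 : ∑ i ∈ Finset.range a, residueSum (-1) (a + 1) (a - i) =
      ∑ i ∈ Finset.range a, residueSum (-1) (a + 1) (i + 1) := by
    rw [← Finset.sum_range_reflect]
    refine Finset.sum_congr rfl fun i hi => ?_
    rw [Finset.mem_range] at hi
    congr 1; omega
  -- Since N = p.1 + 1, the last index i = a is the class of multiples of a+1, removed by h2.
  rw [h1, h1, Finset.sum_range_succ, Finset.sum_range_succ, Finset.sum_sub_distrib, h3]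
  simp only [residueSum, add_assoc] at *
  rw [h2]
  ring

theorem bracket_eq (x : ZQSeriesˣ) {Q : ZQSeries} (hQ : q ∣ Q) :
    bracket x Q = (1 - x) * (qPoch ((x : ZQSeries) * Q) Q *
      qPoch (((x⁻¹ : ZQSeriesˣ) : ZQSeries) * Q) Q) := by
  rw [bracket, qPoch_eq_mul (x : ZQSeries) hQ]
  ring

theorem isUnit_bracket_div {x : ZQSeriesˣ} {Q : ZQSeries} (hQ : q ∣ Q) :
    IsUnit (qPoch ((x : ZQSeries) * Q) Q * qPoch (((x⁻¹ : ZQSeriesˣ) : ZQSeries) * Q) Q) :=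
  (isUnit_qPoch hQ (hQ.mul_left _)).mul (isUnit_qPoch hQ (hQ.mul_left _))

theorem bracket_z_pow_ne_zero {n : ℕ} (hn : n ≠ 0) {Q : ZQSeries} (hQ : q ∣ Q) :
    bracket (z ^ n) Q ≠ 0 := by
  rw [bracket_eq _ hQ]
  refine mul_ne_zero (sub_ne_zero.2 (Ne.symm ?_)) (isUnit_bracket_div hQ).ne_zero
  exact_mod_cast z_pow_ne_one (n := n) (by exact_mod_cast hn)

/-- The Lambert series attached to the residue `i + 1` modulo `a + 1`. -/
noncomputable def residueFactor (a i : ℕ) : ZQSeries :=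
  1 + (1 - (z : ZQSeries) ^ (a + 1)) * (((z⁻¹ ^ (i + 1) : ZQSeriesˣ) : ZQSeries) *
    (residueSum 1 (a + 1) (i + 1) - residueSum (-1) (a + 1) (a - i)))

/-- The right side is the Kronecker bracket 1 - uv + (1-u)(1-v)(Lambert series) at u = 1/z, v =
z^(a+1). The summands 1 of the residue factors form the geometric sum that yields 1 - z^a. -/
theorem sum_residueFactor (a : ℕ) :
    (1 - (z : ZQSeries)) * ∑ i ∈ Finset.range a, (z : ZQSeries) ^ i * residueFactor a i =
      1 - (z : ZQSeries) ^ a + (1 - ((z⁻¹ : ZQSeriesˣ) : ZQSeries)) *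
        (1 - (z : ZQSeries) ^ (a + 1)) *
      (∑' p : ℕ × ℕ, lambertMonomial (-1) (a + 1) (p.1 + 1) p.2 -
        ∑' p : ℕ × ℕ, lambertMonomial 1 (a + 1) (p.1 + 1) p.2) := by
  rw [tsum_lambertMonomial_sub]
  have h1 : ∀ i ∈ Finset.range a, (z : ZQSeries) ^ i * residueFactor a i = (z : ZQSeries) ^ i +
      (1 - (z : ZQSeries) ^ (a + 1)) * ((z⁻¹ : ZQSeriesˣ) : ZQSeries) *
        (residueSum 1 (a + 1) (i + 1) - residueSum (-1) (a + 1) (a - i)) := by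
    intro i _
    have h : (z : ZQSeries) ^ i * ((z⁻¹ ^ (i + 1) : ZQSeriesˣ) : ZQSeries) =
        ((z⁻¹ : ZQSeriesˣ) : ZQSeries) := by
      rw [← Units.val_pow_eq_pow_val, ← Units.val_mul]
      congr 1
      rw [pow_succ, inv_pow, mul_inv_cancel_left]
    rw [residueFactor]
    linear_combination ((1 - (z : ZQSeries) ^ (a + 1)) *
      (residueSum 1 (a + 1) (i + 1) - residueSum (-1) (a + 1) (a - i))) * h
  rw [Finset.sum_congr rfl h1, Finset.sum_add_distrib, ← Finset.mul_sum, mul_add,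
    mul_neg_geom_sum]
  have h2 := Units.mul_inv z
  set S := ∑ i ∈ Finset.range a,
    (residueSum 1 (a + 1) (i + 1) - residueSum (-1) (a + 1) (a - i))
  linear_combination (-(1 - (z : ZQSeries) ^ (a + 1)) * S) * h2

theorem eulerE_sq_mul_bracket (a : ℕ) :
    eulerE q ^ 2 * bracket (z ^ a) q * (1 - (z : ZQSeries) ^ (a + 1)) =
      bracket z q * bracket (z ^ (a + 1)) q *
        ∑ i ∈ Finset.range a, (z : ZQSeries) ^ i * residueFactor a i := by
  have hz1 : ((z⁻¹ : ZQSeriesˣ) : ZQSeries) ≠ 1 := by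
    simpa using z_pow_ne_one (n := -1) (by norm_num)
  have hz : (1 - (z : ZQSeries)) ≠ 0 := by
    refine sub_ne_zero.2 (Ne.symm ?_)
    simpa using z_pow_ne_one (n := 1) (by norm_num)
  have hy' : q ∣ (((z ^ (a + 1))⁻¹ : ZQSeriesˣ) : ZQSeries) * q := dvd_mul_left _ _
  have h := eulerE_sq_mul_qPoch (y := ((z ^ (a + 1) : ZQSeriesˣ) : ZQSeries))
    (y' := (((z ^ (a + 1))⁻¹ : ZQSeriesˣ) : ZQSeries) * q) (Q := q)
    (by rw [← mul_assoc, Units.mul_inv, one_mul]) hy' q_ne_zero z⁻¹ hz1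
  rw [tsum_lambertTerm_mul_zpow hy' dvd_rfl] at h
  have e1 : ∑' p : ℕ × ℕ, ((z⁻¹ : ZQSeriesˣ) : ZQSeries) ^ (p.1 + 1) *
      (((z ^ (a + 1) : ZQSeriesˣ) : ZQSeries) ^ (p.2 + 1) * q ^ ((p.1 + 1) * (p.2 + 1))) =
      ∑' p : ℕ × ℕ, lambertMonomial (-1) (a + 1) (p.1 + 1) p.2 := by
    refine tsum_congr fun p => ?_
    rw [lambertMonomial, ← mul_assoc, ← Units.val_pow_eq_pow_val, ← Units.val_pow_eq_pow_val,
      ← Units.val_mul]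
    congr 2
    rw [← zpow_natCast, ← zpow_natCast, ← zpow_natCast, inv_zpow, ← zpow_neg, ← zpow_mul,
      ← zpow_add]
    congr 1; push_cast; ring
  have e2 : ∑' p : ℕ × ℕ, ((z⁻¹⁻¹ : ZQSeriesˣ) : ZQSeries) ^ (p.1 + 1) *
      (((((z ^ (a + 1))⁻¹ : ZQSeriesˣ) : ZQSeries) * q) ^ (p.2 + 1) * q ^ (p.1 * (p.2 + 1))) =
      ∑' p : ℕ × ℕ, lambertMonomial 1 (a + 1) (p.1 + 1) p.2 := by
    refine tsum_congr fun p => ?_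
    have : ((z ^ ((1 : ℤ) * (((p.1 + 1 : ℕ) : ℤ) - (a + 1 : ℕ) * (p.2 + 1))) : ZQSeriesˣ) :
        ZQSeries) = ((z⁻¹⁻¹ : ZQSeriesˣ) : ZQSeries) ^ (p.1 + 1) *
          (((z ^ (a + 1))⁻¹ : ZQSeriesˣ) : ZQSeries) ^ (p.2 + 1) := by
      rw [← Units.val_pow_eq_pow_val, ← Units.val_pow_eq_pow_val, ← Units.val_mul, inv_inv]
      congr 1
      rw [← zpow_natCast, ← zpow_natCast, ← zpow_natCast, ← zpow_neg, ← zpow_mul, ← zpow_add]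
      congr 1; push_cast; ring
    rw [lambertMonomial, this]
    ring
  have e3 : ((z⁻¹ : ZQSeriesˣ) : ZQSeries) * ((z ^ (a + 1) : ZQSeriesˣ) : ZQSeries) =
      ((z ^ a : ZQSeriesˣ) : ZQSeries) := by
    rw [← Units.val_mul, pow_succ', inv_mul_cancel_left]
  have e4 : ((z⁻¹⁻¹ : ZQSeriesˣ) : ZQSeries) * ((((z ^ (a + 1))⁻¹ : ZQSeriesˣ) : ZQSeries) * q) =
      (((z ^ a)⁻¹ : ZQSeriesˣ) : ZQSeries) * q := by
    rw [← mul_assoc, ← Units.val_mul]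
    congr 2
    rw [inv_inv, pow_succ', mul_inv_rev, mul_comm (z ^ a)⁻¹, mul_inv_cancel_left]
  have e5 := sum_residueFactor a
  rw [e1, e2, e3, e4] at h
  apply mul_left_cancel₀ hz
  rw [mul_left_comm (1 - (z : ZQSeries)) (bracket z q * bracket (z ^ (a + 1)) q), e5, bracket, h, bracket_eq z dvd_rfl,
    bracket_eq _ dvd_rfl, inv_inv]
  simp only [Units.val_pow_eq_pow_val]
  ring

/-- Kronecker's formula in base q^(a+1) with x = z^(a+1) and y = q^(i+1)/x. The product xy = q^(i+1)
is free of z, so the numerator consists of pure q-products. -/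
theorem eulerE_sq_mul_qPoch_residue {a i : ℕ} (hi : i < a) :
    eulerE (q ^ (a + 1)) ^ 2 *
        (qPoch (q ^ (i + 1)) (q ^ (a + 1)) * qPoch (q ^ (a - i)) (q ^ (a + 1))) *
        (1 - (z : ZQSeries) ^ (a + 1)) =
      bracket (z ^ (a + 1)) (q ^ (a + 1)) *
        (qPoch ((((z ^ (a + 1))⁻¹ : ZQSeriesˣ) : ZQSeries) * q ^ (i + 1)) (q ^ (a + 1)) *
          qPoch (((z ^ (a + 1) : ZQSeriesˣ) : ZQSeries) * q ^ (a - i)) (q ^ (a + 1))) *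
        residueFactor a i := by
  obtain ⟨Q, hQd⟩ : ∃ Q, Q = q ^ (a + 1) := ⟨_, rfl⟩
  obtain ⟨x, hxd⟩ : ∃ x : ZQSeriesˣ, x = z ^ (a + 1) := ⟨_, rfl⟩
  obtain ⟨y, hyd⟩ : ∃ y, y = ((x⁻¹ : ZQSeriesˣ) : ZQSeries) * q ^ (i + 1) := ⟨_, rfl⟩
  obtain ⟨y', hyd'⟩ : ∃ y', y' = (x : ZQSeries) * q ^ (a - i) := ⟨_, rfl⟩
  have hQ : q ∣ Q := hQd ▸ dvd_pow_self q a.succ_ne_zero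
  have hyq : q ∣ y := hyd ▸ (dvd_pow_self q i.succ_ne_zero).mul_left _
  have hy' : q ∣ y' := hyd' ▸ (dvd_pow_self q (by omega)).mul_left _
  have hpow : q ^ (i + 1) * q ^ (a - i) = Q := by rw [hQd, ← pow_add]; congr 1; omega
  have hxx := Units.mul_inv x
  have hy : y * y' = Q := by
    rw [hyd, hyd', ← hpow]
    linear_combination (q ^ (i + 1) * q ^ (a - i)) * hxx
  have hxy : (x : ZQSeries) * y = q ^ (i + 1) := by
    rw [hyd]; linear_combination q ^ (i + 1) * hxx
  have hxy' : ((x⁻¹ : ZQSeriesˣ) : ZQSeries) * y' = q ^ (a - i) := by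
    rw [hyd']; linear_combination q ^ (a - i) * hxx
  have hx1 : (x : ZQSeries) ≠ 1 := by
    rw [hxd]; exact_mod_cast z_pow_ne_one (n := a + 1) (by omega)
  have h := eulerE_sq_mul_qPoch hy hy' (hQd ▸ pow_ne_zero _ q_ne_zero) x hx1
  rw [tsum_lambertTerm_mul_zpow hy' hQ, hxy, hxy'] at h
  have hlf : LocFin fun p : ℕ × ℕ => (x : ZQSeries) ^ p.1 * (y ^ (p.2 + 1) * Q ^ (p.1 * (p.2 + 1))) := by
    refine (locFin_pow_mul_pow_mul hQ hyq fun p => 1).of_dvd fun p => ?_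
    exact ⟨(x : ZQSeries) ^ p.1 * (y * Q ^ (p.1 * p.2)), by ring⟩
  -- The residue sum starts at exponent 0 of x while the Lambert series starts at 1; the extra row
  -- is y/(1-y).
  have e1 : ∑' p : ℕ × ℕ, (x : ZQSeries) ^ p.1 * (y ^ (p.2 + 1) * Q ^ (p.1 * (p.2 + 1))) =
      y * Ring.inverse (1 - y) +
      ∑' p : ℕ × ℕ, (x : ZQSeries) ^ (p.1 + 1) * (y ^ (p.2 + 1) * Q ^ ((p.1 + 1) * (p.2 + 1))) := by
    have hinj : Function.Injective fun p : ℕ × ℕ => (p.1 + 1, p.2) := by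
      rintro ⟨a, b⟩ ⟨c, d⟩ h
      simpa using h
    rw [hlf.tsum_prod, hlf.tsum_fiber.tsum_eq_zero_add, (hlf.comp hinj).tsum_prod,
      inverse_one_sub hyq, ← (locFin_pow hyq).summable.tsum_mul_left]
    refine congrArg₂ (· + ·) (tsum_congr fun m => ?_) rfl
    rw [pow_zero, zero_mul, pow_zero]; ring
  have e2 : ((z⁻¹ ^ (i + 1) : ZQSeriesˣ) : ZQSeries) * residueSum 1 (a + 1) (i + 1) =
      ∑' p : ℕ × ℕ, (x : ZQSeries) ^ p.1 * (y ^ (p.2 + 1) * Q ^ (p.1 * (p.2 + 1))) := by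
    have hl : LocFin fun p : ℕ × ℕ => lambertMonomial 1 (a + 1) ((a + 1) * p.1 + (i + 1)) p.2 :=
      (locFin_lambertMonomial 1 (a + 1)).comp (e := fun p : ℕ × ℕ => ((a + 1) * p.1 + i, p.2)) (by
        rintro ⟨b, c⟩ ⟨d, e⟩ h
        simpa using h)
    rw [residueSum, ← hl.summable.tsum_mul_left]
    refine tsum_congr fun p => ?_
    have : ((z⁻¹ ^ (i + 1) : ZQSeriesˣ) : ZQSeries) * ((z ^ ((1 : ℤ) *
        ((((a + 1) * p.1 + (i + 1) : ℕ) : ℤ) - (a + 1 : ℕ) * (p.2 + 1))) : ZQSeriesˣ) :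
        ZQSeries) = (x : ZQSeries) ^ p.1 * ((x⁻¹ : ZQSeriesˣ) : ZQSeries) ^ (p.2 + 1) := by
      rw [← Units.val_pow_eq_pow_val, ← Units.val_pow_eq_pow_val, ← Units.val_mul, ← Units.val_mul]
      congr 1
      rw [hxd, inv_pow, inv_pow, ← zpow_natCast, ← zpow_natCast, ← zpow_natCast, ← zpow_neg,
        ← zpow_natCast, ← zpow_mul, ← zpow_mul, ← zpow_neg, ← zpow_add, ← zpow_add]
      congr 1; push_cast; ring
    rw [lambertMonomial, ← mul_assoc, this, hyd, hQd]
    ring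
  have e3 : ((z⁻¹ ^ (i + 1) : ZQSeriesˣ) : ZQSeries) * residueSum (-1) (a + 1) (a - i) =
      ∑' p : ℕ × ℕ, ((x⁻¹ : ZQSeriesˣ) : ZQSeries) ^ (p.1 + 1) *
        (y' ^ (p.2 + 1) * Q ^ (p.1 * (p.2 + 1))) := by
    have hl : LocFin fun p : ℕ × ℕ => lambertMonomial (-1) (a + 1) ((a + 1) * p.1 + (a - i)) p.2 := by
      have := (locFin_lambertMonomial (-1) (a + 1)).comp
        (e := fun p : ℕ × ℕ => ((a + 1) * p.1 + (a - i - 1), p.2)) (by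
        rintro ⟨b, c⟩ ⟨d, e⟩ h
        simpa using h)
      simpa only [add_assoc, show a - i - 1 + 1 = a - i by omega] using this
    rw [residueSum, ← hl.summable.tsum_mul_left]
    refine tsum_congr fun p => ?_
    have : ((z⁻¹ ^ (i + 1) : ZQSeriesˣ) : ZQSeries) * ((z ^ ((-1 : ℤ) *
        ((((a + 1) * p.1 + (a - i) : ℕ) : ℤ) - (a + 1 : ℕ) * (p.2 + 1))) : ZQSeriesˣ) :
        ZQSeries) = ((x⁻¹ : ZQSeriesˣ) : ZQSeries) ^ (p.1 + 1) * (x : ZQSeries) ^ (p.2 + 1) := by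
      rw [← Units.val_pow_eq_pow_val, ← Units.val_pow_eq_pow_val, ← Units.val_mul, ← Units.val_mul]
      congr 1
      rw [hxd, inv_pow, inv_pow, ← zpow_natCast, ← zpow_natCast, ← zpow_natCast, ← zpow_neg,
        ← zpow_natCast, ← zpow_mul, ← zpow_mul, ← zpow_neg, ← zpow_add, ← zpow_add]
      congr 1; push_cast [Nat.cast_sub hi.le]; ring
    rw [lambertMonomial, ← mul_assoc, this, hyd', hQd]
    ring
  -- This is Kronecker's bracket divided by 1 - y, because (1-y)(1 + (1-x)y/(1-y)) = 1 - xy.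
  have e4 : residueFactor a i = 1 + (1 - (x : ZQSeries)) * (y * Ring.inverse (1 - y) +
      ∑' n : ℤ, lambertTerm y y' Q n * ((x ^ n : ZQSeriesˣ) : ZQSeries)) := by
    rw [residueFactor, mul_sub, e2, e3, e1, tsum_lambertTerm_mul_zpow hy' hQ, hxd,
      Units.val_pow_eq_pow_val]
    ring
  have e5 := mul_inverse (isUnit_one_sub hyq)
  rw [e4, tsum_lambertTerm_mul_zpow hy' hQ, ← hQd, ← hxd, ← hyd, ← hyd', bracket_eq x hQ,
    qPoch_eq_mul y hQ, h, ← Units.val_pow_eq_pow_val, ← hxd]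
  rw [← hxy]
  linear_combination (-(1 - (x : ZQSeries)) * (qPoch ((x : ZQSeries) * Q) Q *
      qPoch (((x⁻¹ : ZQSeriesˣ) : ZQSeries) * Q) Q) * (qPoch (y * Q) Q * qPoch y' Q) *
      (1 - (x : ZQSeries)) * y) * e5

end QSeries

namespace QSeries

/-! ### Series with nonnegative coefficients -/

theorem tsum_mem_of_isClosed {ι : Type*} (S : AddSubmonoid ZQSeries)
    (hS : IsClosed (S : Set ZQSeries)) {f : ι → ZQSeries} (hf : Summable f)
    (h : ∀ i, f i ∈ S) : ∑' i, f i ∈ S :=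
  hS.mem_of_tendsto hf.hasSum (Filter.Eventually.of_forall fun s => sum_mem fun i _ => h i)

/-- Coefficients are discrete, so any coefficientwise condition is closed and passes to infinite
sums. It serves for nonnegative series, for series free of z, and for series without z^0 terms. -/
theorem isClosed_setOf_coeff_mem (S : Set ℤ[T;T⁻¹]) :
    IsClosed {F : ZQSeries | ∀ n, PowerSeries.coeff n F ∈ S} := by
  rw [Set.ofPred_forall]
  exact isClosed_iInter fun n => (isClosed_discrete S).preimage
    (PowerSeries.WithPiTopology.continuous_coeff _ n)

/-- Laurent polynomials with nonnegative coefficients. -/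
def nonnegLaurent : Subsemiring ℤ[T;T⁻¹] where
  carrier := {p | ∀ m, 0 ≤ p.coeff m}
  zero_mem' m := by simp
  one_mem' m := by
    rw [← LaurentPolynomial.T_zero, LaurentPolynomial.T_apply]
    split_ifs <;> simp
  add_mem' hp hr m := by
    rw [AddMonoidAlgebra.coeff_add, Finsupp.add_apply]
    exact add_nonneg (hp m) (hr m)
  mul_mem' {p r} hp hr m := by
    classical
    rw [AddMonoidAlgebra.coeff_mul]
    refine Finset.sum_nonneg fun i _ => Finset.sum_nonneg fun j _ => ?_
    beta_reduce
    split_ifs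
    · exact mul_nonneg (hp i) (hr j)
    · exact le_rfl

/-- Series with nonnegative coefficients. -/
def nonnegSeries : Subsemiring ZQSeries where
  carrier := {F | ∀ n, PowerSeries.coeff n F ∈ nonnegLaurent}
  zero_mem' n := by simp
  one_mem' n := by
    rw [PowerSeries.coeff_one]
    split_ifs
    · exact one_mem _
    · exact zero_mem _
  add_mem' hF hG n := by
    rw [map_add]
    exact add_mem (hF n) (hG n)
  mul_mem' {F G} hF hG n := by
    rw [PowerSeries.coeff_mul]
    exact sum_mem fun p _ => mul_mem (hF _) (hG _)

theorem isClosed_nonnegSeries : IsClosed (nonnegSeries : Set ZQSeries) :=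
  isClosed_setOf_coeff_mem _

theorem tsum_mem_nonnegSeries {ι : Type*} {f : ι → ZQSeries} (hf : Summable f)
    (h : ∀ i, f i ∈ nonnegSeries) : ∑' i, f i ∈ nonnegSeries :=
  tsum_mem_of_isClosed nonnegSeries.toAddSubmonoid isClosed_nonnegSeries hf h

theorem q_mem_nonnegSeries : q ∈ nonnegSeries := fun n => by
  rw [q, PowerSeries.coeff_X]
  split_ifs
  · exact one_mem _
  · exact zero_mem _

theorem zpow_mem_nonnegSeries (n : ℤ) : ((z ^ n : ZQSeriesˣ) : ZQSeries) ∈ nonnegSeries := by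
  rw [val_z_zpow]
  intro m
  rw [PowerSeries.coeff_C]
  split_ifs
  · intro k
    rw [LaurentPolynomial.T_apply]
    split_ifs <;> simp
  · exact zero_mem _

theorem inverse_one_sub_mem {x : ZQSeries} (hx : q ∣ x) (h : x ∈ nonnegSeries) :
    Ring.inverse (1 - x) ∈ nonnegSeries := by
  rw [inverse_one_sub hx]
  exact tsum_mem_nonnegSeries (locFin_pow hx).summable fun n => pow_mem h n

theorem invPoch_succ (Q : ZQSeries) (n : ℕ) :
    invPoch Q (n + 1) = Ring.inverse (1 - Q ^ (n + 1)) * invPoch Q n := by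
  rw [invPoch, invPoch, finPoch_self_succ, Ring.mul_inverse_rev]

/-! ### Positivity of reciprocal products and of the corrected crank -/

section

variable {Q : ZQSeries}

theorem inverse_one_sub_pow_mem (hQ : q ∣ Q) (hQ' : Q ∈ nonnegSeries) (n : ℕ) :
    Ring.inverse (1 - Q ^ (n + 1)) ∈ nonnegSeries :=
  inverse_one_sub_mem (hQ.trans (dvd_pow_self Q n.succ_ne_zero)) (pow_mem hQ' _)

theorem invPoch_mem (hQ : q ∣ Q) (hQ' : Q ∈ nonnegSeries) (n : ℕ) :
    invPoch Q n ∈ nonnegSeries := by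
  induction n with
  | zero => rw [invPoch_zero]; exact one_mem _
  | succ n ih => rw [invPoch_succ]; exact mul_mem (inverse_one_sub_pow_mem hQ hQ' n) ih

theorem one_sub_mul_invPoch_one (hQ : q ∣ Q) : (1 - Q) * invPoch Q 1 = 1 := by
  simpa using one_sub_mul_invPoch_succ hQ 0

/-- 1 - Q is the first factor of (Q;Q)_(n+1), so it cancels. -/
theorem one_sub_mul_invPoch_mem (hQ : q ∣ Q) (hQ' : Q ∈ nonnegSeries) (n : ℕ) :
    (1 - Q) * invPoch Q (n + 1) ∈ nonnegSeries := by
  induction n with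
  | zero => rw [zero_add, one_sub_mul_invPoch_one hQ]; exact one_mem _
  | succ n ih =>
    rw [invPoch_succ, mul_left_comm]
    exact mul_mem (inverse_one_sub_pow_mem hQ hQ' _) ih

theorem inverse_qPoch_sub_one_mem {x : ZQSeries} (hQ : q ∣ Q) (hx : q ∣ x)
    (hQ' : Q ∈ nonnegSeries) (hx' : x ∈ nonnegSeries) :
    Ring.inverse (qPoch x Q) - 1 ∈ nonnegSeries := by
  have h := (locFin_pow hx).mul_left (invPoch Q)
  rw [inverse_qPoch_eq_tsum hQ hx, h.tsum_eq_zero_add]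
  simp only [invPoch_zero, pow_zero, mul_one, add_sub_cancel_left]
  exact tsum_mem_nonnegSeries (h.comp (add_left_injective 1)).summable
    fun n => mul_mem (invPoch_mem hQ hQ' _) (pow_mem hx' _)

theorem inverse_qPoch_mem {x : ZQSeries} (hQ : q ∣ Q) (hx : q ∣ x)
    (hQ' : Q ∈ nonnegSeries) (hx' : x ∈ nonnegSeries) :
    Ring.inverse (qPoch x Q) ∈ nonnegSeries := by
  simpa using add_mem (inverse_qPoch_sub_one_mem hQ hx hQ' hx') (one_mem _)

theorem finPoch_mul_inverse_qPoch {x : ZQSeries} (hQ : q ∣ Q) (hx : q ∣ x) (n : ℕ) :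
    finPoch x Q n * Ring.inverse (qPoch x Q) = Ring.inverse (qPoch (x * Q ^ n) Q) := by
  apply (isUnit_qPoch hQ (hx.mul_right (Q ^ n))).mul_left_cancel
  rw [mul_inverse (isUnit_qPoch hQ (hx.mul_right (Q ^ n))), ← mul_assoc,
    mul_comm (qPoch (x * Q ^ n) Q), finPoch_mul_qPoch x hQ, mul_inverse (isUnit_qPoch hQ hx)]

/-- The q-binomial theorem with b = x', after (x';Q)_n/(x';Q)_∞ = 1/(x'Q^n;Q)_∞. Every term on the
right is nonnegative as soon as x, x' and Q are. -/
theorem qPoch_mul_mul_inverse {x x' : ZQSeries} (hQ : q ∣ Q) (hx : q ∣ x) (hx' : q ∣ x') :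
    qPoch (x' * x) Q * (Ring.inverse (qPoch x Q) * Ring.inverse (qPoch x' Q)) =
      ∑' n : ℕ, Ring.inverse (qPoch (x' * Q ^ n) Q) * (invPoch Q n * x ^ n) := by
  have h := (locFin_pow hx).mul_left fun n => finPoch x' Q n * invPoch Q n
  have h1 := mul_inverse (isUnit_qPoch hQ hx)
  have h2 : ∑' n : ℕ, Ring.inverse (qPoch (x' * Q ^ n) Q) * (invPoch Q n * x ^ n) =
      (∑' n : ℕ, finPoch x' Q n * invPoch Q n * x ^ n) * Ring.inverse (qPoch x' Q) := by
    rw [← h.summable.tsum_mul_right]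
    exact tsum_congr fun n => by rw [← finPoch_mul_inverse_qPoch hQ hx']; ring
  rw [qPoch_mul_eq_tsum hQ hx, h2]
  linear_combination ((∑' n : ℕ, finPoch x' Q n * invPoch Q n * x ^ n) *
    Ring.inverse (qPoch x' Q)) * h1

/-- `(Q;Q)_∞ / ((x;Q)_∞ (Q/x;Q)_∞)` has nonnegative coefficients. -/
theorem eulerE_div_qPoch_mem {x x' : ZQSeries} (h : x' * x = Q) (hx : q ∣ x) (hx' : q ∣ x')
    (hxm : x ∈ nonnegSeries) (hxm' : x' ∈ nonnegSeries) :
    eulerE Q * (Ring.inverse (qPoch x Q) * Ring.inverse (qPoch x' Q)) ∈ nonnegSeries := by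
  have hQ : q ∣ Q := h ▸ hx.mul_left x'
  have hQm : Q ∈ nonnegSeries := h ▸ mul_mem hxm' hxm
  have e := qPoch_mul_mul_inverse hQ hx hx'
  rw [h, ← eulerE_eq] at e
  rw [e]
  refine tsum_mem_nonnegSeries (((locFin_pow hx).mul_left _).mul_left _).summable fun n => ?_
  exact mul_mem (inverse_qPoch_mem hQ (hx'.mul_right _) hQm (mul_mem hxm' (pow_mem hQm n)))
    (mul_mem (invPoch_mem hQ hQm n) (pow_mem hxm n))

/-- The crank generating function is nonnegative up to the correction at `Q`. -/
theorem crank_sub_mem (x : ZQSeriesˣ) (hQ : q ∣ Q) (hQm : Q ∈ nonnegSeries)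
    (hx : (x : ZQSeries) ∈ nonnegSeries) (hx' : ((x⁻¹ : ZQSeriesˣ) : ZQSeries) ∈ nonnegSeries) :
    eulerE Q * (Ring.inverse (qPoch (((x⁻¹ : ZQSeriesˣ) : ZQSeries) * Q) Q) *
      Ring.inverse (qPoch ((x : ZQSeries) * Q) Q)) -
      (1 - Q + x * Q + ((x⁻¹ : ZQSeriesˣ) : ZQSeries) * Q) ∈ nonnegSeries := by
  set w : ZQSeries := ((x⁻¹ : ZQSeriesˣ) : ZQSeries) * Q with hw
  set v : ZQSeries := (x : ZQSeries) * Q with hv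
  have hwq : q ∣ w := hQ.mul_left _
  have hvq : q ∣ v := hQ.mul_left _
  have hwm : w ∈ nonnegSeries := mul_mem hx' hQm
  have hvm : v ∈ nonnegSeries := mul_mem hx hQm
  have hvw : v * w = Q * Q := by
    rw [hv, hw]; linear_combination Q * Q * Units.mul_inv x
  have e0 := qPoch_mul_mul_inverse hQ hwq hvq
  have l0 : LocFin fun n : ℕ => Ring.inverse (qPoch (v * Q ^ n) Q) * (invPoch Q n * w ^ n) :=
    ((locFin_pow hwq).mul_left _).mul_left _
  have l1 : LocFin fun n : ℕ => invPoch Q n * v ^ n := (locFin_pow hvq).mul_left _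
  have e1 := l0.tsum_eq_zero_add
  have l2 := l0.comp (add_left_injective 1)
  have e2 := l2.tsum_eq_zero_add
  have e3 := l1.tsum_eq_zero_add
  have l3 := l1.comp (add_left_injective 1)
  have e4 := l3.tsum_eq_zero_add
  have l4 := l2.comp (add_left_injective 1)
  have l5 := l3.comp (add_left_injective 1)
  -- With E(Q) = (1-Q)(vw;Q)_∞, the expansion in w has nonnegative terms from w^2 on (m1). Its w^0
  -- term is (1-Q)/(v;Q)_∞ = 1 - Q + v plus a nonnegative series (m2), and its w^1 term is w plus a
  -- nonnegative series (m3).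
  have m1 : (1 - Q) * ∑' n : ℕ, Ring.inverse (qPoch (v * Q ^ (n + 1 + 1)) Q) *
      (invPoch Q (n + 1 + 1) * w ^ (n + 1 + 1)) ∈ nonnegSeries := by
    rw [← l4.summable.tsum_mul_left]
    refine tsum_mem_nonnegSeries (l4.mul_left _).summable fun n => ?_
    have := mul_mem (mul_mem (inverse_qPoch_mem hQ (hvq.mul_right _) hQm
      (mul_mem hvm (pow_mem hQm (n + 1 + 1)))) (one_sub_mul_invPoch_mem hQ hQm (n + 1)))
      (pow_mem hwm (n + 1 + 1))
    convert this using 1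
    ring
  have m2 : (1 - Q) * ∑' n : ℕ, invPoch Q (n + 1 + 1) * v ^ (n + 1 + 1) ∈ nonnegSeries := by
    rw [← l5.summable.tsum_mul_left]
    refine tsum_mem_nonnegSeries (l5.mul_left _).summable fun n => ?_
    have := mul_mem (one_sub_mul_invPoch_mem hQ hQm (n + 1)) (pow_mem hvm (n + 1 + 1))
    convert this using 1
    ring
  have m3 := mul_mem (inverse_qPoch_sub_one_mem hQ (hvq.mul_right (Q ^ 1)) hQm
    (mul_mem hvm (pow_mem hQm 1))) hwm
  have h1 := one_sub_mul_invPoch_one hQ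
  rw [← inverse_qPoch_eq_tsum hQ hvq] at e3
  simp only [pow_zero, mul_one, invPoch_zero, zero_add, pow_one] at e1 e2 e3 e4 m3
  have e5 : eulerE Q = (1 - Q) * qPoch (v * w) Q := by
    rw [eulerE_eq, qPoch_eq_mul Q hQ, hvw]
  convert add_mem (add_mem m1 m2) m3 using 1
  rw [e5]
  set I1 := Ring.inverse (qPoch (v * Q) Q)
  linear_combination (1 - Q) * (e0 + e1 + e2 + e3 + e4) + (I1 * w + v) * h1

/-- (1 - x^k)/(1 - x) is a geometric sum, so the quotient is that sum times the crank series; k ≥ 2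
makes the sum long enough to absorb the term -Q. -/
theorem exists_mul_bracket_eq (x : ZQSeriesˣ) (hQ : q ∣ Q) (hQm : Q ∈ nonnegSeries)
    (hx : (x : ZQSeries) ∈ nonnegSeries) (hx' : ((x⁻¹ : ZQSeriesˣ) : ZQSeries) ∈ nonnegSeries)
    {k : ℕ} (hk : 2 ≤ k) :
    ∃ A ∈ nonnegSeries, A * bracket x Q = (1 - (x : ZQSeries) ^ k) * eulerE Q := by
  obtain ⟨j, rfl⟩ := Nat.exists_eq_add_of_le' hk
  have h := crank_sub_mem x hQ hQm hx hx'
  set C := eulerE Q * (Ring.inverse (qPoch (((x⁻¹ : ZQSeriesˣ) : ZQSeries) * Q) Q) *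
      Ring.inverse (qPoch ((x : ZQSeries) * Q) Q)) with hC
  refine ⟨(∑ i ∈ Finset.range (j + 2), (x : ZQSeries) ^ i) * C, ?_, ?_⟩
  · have m1 : (∑ i ∈ Finset.range (j + 2), (x : ZQSeries) ^ i) ∈ nonnegSeries :=
      sum_mem fun i _ => pow_mem hx i
    -- With S = 1 + x + ... + x^(k-1) and k = j+2, S(x + 1/x - 1) = x^k + 1/x + x + ... + x^(k-2).
    have m2 : (x : ZQSeries) ^ (j + 2) + ((x⁻¹ : ZQSeriesˣ) : ZQSeries) +
        (∑ i ∈ Finset.range j, (x : ZQSeries) ^ (i + 1)) ∈ nonnegSeries :=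
      add_mem (add_mem (pow_mem hx _) hx') (sum_mem fun i _ => pow_mem hx _)
    convert add_mem (add_mem (mul_mem m1 h) m1) (mul_mem m2 hQm) using 1
    have e1 := mul_neg_geom_sum (x : ZQSeries) (j + 2)
    have e2 : (∑ i ∈ Finset.range (j + 2), (x : ZQSeries) ^ i) * ((x⁻¹ : ZQSeriesˣ) : ZQSeries) =
        ((x⁻¹ : ZQSeriesˣ) : ZQSeries) + 1 + ∑ i ∈ Finset.range j, (x : ZQSeries) ^ (i + 1) := by
      rw [Finset.sum_range_succ', Finset.sum_range_succ', add_mul, add_mul, Finset.sum_mul]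
      have : ∀ i, (x : ZQSeries) ^ (i + 1 + 1) * ((x⁻¹ : ZQSeriesˣ) : ZQSeries) =
          (x : ZQSeries) ^ (i + 1) := fun i => by
        rw [pow_succ _ (i + 1), mul_assoc, Units.mul_inv, mul_one]
      rw [Finset.sum_congr rfl fun i _ => this i]
      simp only [zero_add, pow_one, Units.mul_inv, pow_zero]
      ring
    linear_combination (-Q) * e1 + Q * e2
  · have e1 := mul_neg_geom_sum (x : ZQSeries) (j + 2)
    have e2 := mul_inverse (isUnit_qPoch hQ (hQ.mul_left ((x⁻¹ : ZQSeriesˣ) : ZQSeries)))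
    have e3 := mul_inverse (isUnit_qPoch hQ (hQ.mul_left (x : ZQSeries)))
    rw [bracket_eq x hQ, hC, ← e1]
    linear_combination ((1 - (x : ZQSeries)) * (∑ i ∈ Finset.range (j + 2), (x : ZQSeries) ^ i) *
      eulerE Q) * (e2 + qPoch (((x⁻¹ : ZQSeriesˣ) : ZQSeries) * Q) Q *
        Ring.inverse (qPoch (((x⁻¹ : ZQSeriesˣ) : ZQSeries) * Q) Q) * e3)

end

end QSeries

namespace QSeries

/-! ### Generating functions of cores -/

/-- Series that do not involve `z`. -/
noncomputable def zFreeSeries : Subring ZQSeries :=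
  (PowerSeries.map (LaurentPolynomial.C : ℤ →+* ℤ[T;T⁻¹])).range

theorem mem_zFreeSeries {F : ZQSeries} :
    F ∈ zFreeSeries ↔ ∀ n, PowerSeries.coeff n F ∈ Set.range (LaurentPolynomial.C (R := ℤ)) := by
  constructor
  · rintro ⟨f, rfl⟩ n
    exact ⟨PowerSeries.coeff n f, by simp⟩
  · intro h
    choose f hf using h
    exact ⟨PowerSeries.mk f, by ext1 n; simp [hf]⟩

theorem tsum_mem_zFreeSeries {ι : Type*} {f : ι → ZQSeries} (hf : Summable f)
    (h : ∀ i, f i ∈ zFreeSeries) : ∑' i, f i ∈ zFreeSeries := by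
  refine tsum_mem_of_isClosed zFreeSeries.toAddSubmonoid ?_ hf h
  convert isClosed_setOf_coeff_mem (Set.range (LaurentPolynomial.C (R := ℤ))) using 1
  ext F
  exact mem_zFreeSeries

theorem q_mem_zFreeSeries : q ∈ zFreeSeries := ⟨PowerSeries.X, by simp [q]⟩

theorem invPoch_mem_zFreeSeries {Q : ZQSeries} (hQ : q ∣ Q) (h : Q ∈ zFreeSeries) (n : ℕ) :
    invPoch Q n ∈ zFreeSeries := by
  induction n with
  | zero => rw [invPoch_zero]; exact one_mem _
  | succ n ih =>
    have hn : q ∣ Q ^ (n + 1) := hQ.trans (dvd_pow_self Q n.succ_ne_zero)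
    rw [invPoch_succ, inverse_one_sub hn]
    exact mul_mem (tsum_mem_zFreeSeries (locFin_pow hn).summable fun m =>
      pow_mem (pow_mem h _) m) ih

theorem eulerE_mem_zFreeSeries {Q : ZQSeries} (hQ : q ∣ Q) (h : Q ∈ zFreeSeries) :
    eulerE Q ∈ zFreeSeries := by
  rw [eulerE_eq, qPoch_eq_tsum Q hQ]
  exact tsum_mem_zFreeSeries
    (((locFin_nat_sub (pow_dvd_pow_choose hQ)).mul_right _).mul_right _).summable
    fun n => mul_mem (mul_mem (pow_mem h _) (invPoch_mem_zFreeSeries hQ h n))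
      (pow_mem (neg_mem h) n)

theorem inverse_eulerE_mem_zFreeSeries {Q : ZQSeries} (hQ : q ∣ Q) (h : Q ∈ zFreeSeries) :
    Ring.inverse (eulerE Q) ∈ zFreeSeries := by
  rw [eulerE_eq, inverse_qPoch_eq_tsum hQ hQ]
  exact tsum_mem_zFreeSeries ((locFin_pow hQ).mul_left _).summable
    fun n => mul_mem (invPoch_mem_zFreeSeries hQ h n) (pow_mem h n)

/-- Series without any monomial `z^0 q^n`. -/
def noConstantSeries : AddSubmonoid ZQSeries where
  carrier := {F | ∀ n, PowerSeries.coeff n F ∈ {p : ℤ[T;T⁻¹] | p.coeff 0 = 0}}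
  zero_mem' n := by simp
  add_mem' hF hG n := by
    simp only [Set.mem_ofPred_eq] at *
    rw [map_add, AddMonoidAlgebra.coeff_add, Finsupp.add_apply, hF n, hG n, add_zero]

theorem mul_zpow_mem_noConstantSeries {F : ZQSeries} (hF : F ∈ zFreeSeries) {k : ℤ}
    (hk : k ≠ 0) : F * ((z ^ k : ZQSeriesˣ) : ZQSeries) ∈ noConstantSeries := by
  intro n
  obtain ⟨r, hr⟩ := mem_zFreeSeries.1 hF n
  rw [val_z_zpow, PowerSeries.coeff_mul_C, ← hr]
  change (LaurentPolynomial.C r * LaurentPolynomial.T k).coeff 0 = 0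
  rw [← LaurentPolynomial.single_eq_C_mul_T, AddMonoidAlgebra.coeff_single, Finsupp.single_apply,
    if_neg hk]

/-- If `c` is free of `z` and `c` times the theta series in `z` has nonnegative coefficients, then
so does `c`. -/
theorem mem_nonnegSeries_of_mul_theta {c Q : ZQSeries} (hQ : q ∣ Q) (hQz : Q ∈ zFreeSeries)
    (hc : c ∈ zFreeSeries)
    (h : c * ∑' n, thetaTerm z (((z⁻¹ : ZQSeriesˣ) : ZQSeries) * Q) Q n ∈ nonnegSeries) :
    c ∈ nonnegSeries := by
  have hl := locFin_thetaTerm z (((z⁻¹ : ZQSeriesˣ) : ZQSeries) * Q) hQ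
  have l1 := hl.comp (e := fun n : ℕ => (n : ℤ)) Nat.cast_injective
  have l2 := hl.comp (e := fun n : ℕ => -((n : ℤ) + 1)) (fun a b h => by simpa using h)
  have l3 := l1.comp (e := fun n : ℕ => n + 1) (add_left_injective 1)
  have e1 := hl.tsum_int
  rw [l1.tsum_eq_zero_add] at e1
  have e0 : thetaTerm z (((z⁻¹ : ZQSeriesˣ) : ZQSeries) * Q) Q ((0 : ℕ) : ℤ) = 1 := by
    rw [thetaTerm_natCast]; simp
  have hcl : IsClosed (noConstantSeries : Set ZQSeries) := isClosed_setOf_coeff_mem _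
  -- The z^0 part of c times the theta series is c itself: the n = 0 term is 1, and since c is free
  -- of z, all other terms carry a nonzero power of z.
  have m1 : c * ∑' n : ℕ, thetaTerm z (((z⁻¹ : ZQSeriesˣ) : ZQSeries) * Q) Q ((n + 1 : ℕ) : ℤ) ∈
      noConstantSeries := by
    rw [← l3.summable.tsum_mul_left]
    refine tsum_mem_of_isClosed _ hcl (l3.mul_left _).summable fun n => ?_
    convert mul_zpow_mem_noConstantSeries (mul_mem hc (pow_mem hQz ((n + 1).choose 2)))
      (k := ((n + 1 : ℕ) : ℤ)) (by omega) using 1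
    rw [thetaTerm_natCast, zpow_natCast, Units.val_pow_eq_pow_val]
    ring
  have m2 : c * ∑' n : ℕ, thetaTerm z (((z⁻¹ : ZQSeriesˣ) : ZQSeries) * Q) Q (-((n : ℤ) + 1)) ∈
      noConstantSeries := by
    rw [← l2.summable.tsum_mul_left]
    refine tsum_mem_of_isClosed _ hcl (l2.mul_left _).summable fun n => ?_
    convert mul_zpow_mem_noConstantSeries (mul_mem hc (pow_mem hQz (n + 1 + (n + 1).choose 2)))
      (k := -((n + 1 : ℕ) : ℤ)) (by omega) using 1
    rw [← Nat.cast_succ, thetaTerm_neg_natCast, zpow_neg, zpow_natCast, ← inv_pow,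
      Units.val_pow_eq_pow_val, Nat.succ_eq_add_one]
    ring
  intro n m
  obtain ⟨r, hr⟩ := mem_zFreeSeries.1 hc n
  rcases eq_or_ne m 0 with rfl | hm
  · have h0 := h n 0
    rw [e1, e0, mul_add, mul_add, mul_one, map_add, map_add, AddMonoidAlgebra.coeff_add,
      AddMonoidAlgebra.coeff_add, Finsupp.add_apply, Finsupp.add_apply] at h0
    have h1 : (PowerSeries.coeff n (c * ∑' n : ℕ, thetaTerm z
      (((z⁻¹ : ZQSeriesˣ) : ZQSeries) * Q) Q ((n + 1 : ℕ) : ℤ))).coeff 0 = 0 := m1 n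
    have h2 : (PowerSeries.coeff n (c * ∑' n : ℕ, thetaTerm z
      (((z⁻¹ : ZQSeriesˣ) : ZQSeries) * Q) Q (-((n : ℤ) + 1)))).coeff 0 = 0 := m2 n
    rw [h1, h2] at h0
    simpa using h0
  · rw [← hr, LaurentPolynomial.C_apply, if_neg hm]

theorem thetaTerm_mem {x x' Q : ZQSeries} (hx : x ∈ nonnegSeries) (hx' : x' ∈ nonnegSeries)
    (hQ : Q ∈ nonnegSeries) (n : ℤ) : thetaTerm x x' Q n ∈ nonnegSeries := by
  cases n
  · exact mul_mem (pow_mem hx _) (pow_mem hQ _)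
  · exact mul_mem (pow_mem hx' _) (pow_mem hQ _)

theorem z_mem_nonnegSeries : (z : ZQSeries) ∈ nonnegSeries := by
  simpa using zpow_mem_nonnegSeries 1

theorem z_inv_mem_nonnegSeries : ((z⁻¹ : ZQSeriesˣ) : ZQSeries) ∈ nonnegSeries := by
  simpa using zpow_mem_nonnegSeries (-1)

/-- The generating function of `s`-cores has nonnegative coefficients. -/
theorem eulerE_pow_div_eulerE_mem {p : ZQSeries} (hp : q ∣ p) (hpz : p ∈ zFreeSeries)
    (hpm : p ∈ nonnegSeries) {s : ℕ} (hs : 0 < s) :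
    eulerE (p ^ s) ^ s * Ring.inverse (eulerE p) ∈ nonnegSeries := by
  have hps : q ∣ p ^ s := hp.trans (dvd_pow_self p hs.ne')
  refine mem_nonnegSeries_of_mul_theta hp hpz
    (mul_mem (pow_mem (eulerE_mem_zFreeSeries hps (pow_mem hpz s)) s)
      (inverse_eulerE_mem_zFreeSeries hp hpz)) ?_
  have hzz := Units.mul_inv z
  rw [← jacobi_triple_product (by rw [← mul_assoc, hzz, one_mul]) (hp.mul_left _)]
  have h1 : qPoch (-(((z⁻¹ : ZQSeriesˣ) : ZQSeries) * p)) p =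
      ∏ j ∈ Finset.range s, qPoch (-(((z⁻¹ : ZQSeriesˣ) : ZQSeries) * p ^ (s - j))) (p ^ s) := by
    rw [qPoch_eq_prod_range _ hp hs, ← Finset.prod_range_reflect]
    refine Finset.prod_congr rfl fun j hj => ?_
    rw [Finset.mem_range] at hj
    congr 1
    rw [neg_mul, mul_assoc, ← pow_succ', show s - 1 - j + 1 = s - j by omega]
  have h2 : qPoch (-(z : ZQSeries)) p =
      ∏ j ∈ Finset.range s, qPoch (-((z : ZQSeries) * p ^ j)) (p ^ s) := by
    rw [qPoch_eq_prod_range _ hp hs]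
    exact Finset.prod_congr rfl fun j _ => by rw [neg_mul]
  have h3 := mul_inverse (isUnit_eulerE hp)
  -- The theta series in base p, times the quotient, splits modulo s into a product of s theta
  -- series in base p^s, each with nonnegative coefficients.
  have h4 : eulerE (p ^ s) ^ s * Ring.inverse (eulerE p) * (eulerE p *
      (qPoch (-(z : ZQSeries)) p * qPoch (-(((z⁻¹ : ZQSeriesˣ) : ZQSeries) * p)) p)) =
      ∏ j ∈ Finset.range s, eulerE (p ^ s) * (qPoch (-((z : ZQSeries) * p ^ j)) (p ^ s) *
        qPoch (-(((z⁻¹ : ZQSeriesˣ) : ZQSeries) * p ^ (s - j))) (p ^ s)) := by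
    rw [Finset.prod_mul_distrib, Finset.prod_mul_distrib, ← h1, ← h2, Finset.prod_const,
      Finset.card_range]
    linear_combination (eulerE (p ^ s) ^ s * (qPoch (-(z : ZQSeries)) p *
      qPoch (-(((z⁻¹ : ZQSeriesˣ) : ZQSeries) * p)) p)) * h3
  rw [h4]
  refine prod_mem fun j hj => ?_
  rw [Finset.mem_range] at hj
  have hx : (z : ZQSeries) * p ^ j * (((z⁻¹ : ZQSeriesˣ) : ZQSeries) * p ^ (s - j)) = p ^ s := by
    have : p ^ j * p ^ (s - j) = p ^ s := by rw [← pow_add]; congr 1; omega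
    rw [← this]
    linear_combination (p ^ j * p ^ (s - j)) * hzz
  rw [jacobi_triple_product hx ((hp.trans (dvd_pow_self p (by omega))).mul_left _)]
  exact tsum_mem_nonnegSeries (locFin_thetaTerm _ _ hps).summable fun n =>
    thetaTerm_mem (mul_mem z_mem_nonnegSeries (pow_mem hpm _))
      (mul_mem z_inv_mem_nonnegSeries (pow_mem hpm _)) (pow_mem hpm _) n

theorem qPoch_eq_mul_sq (x : ZQSeries) {p : ZQSeries} (hp : q ∣ p) :
    qPoch x p = qPoch x (p ^ 2) * qPoch (x * p) (p ^ 2) := by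
  have h := qPoch_eq_prod_range x hp two_pos
  rwa [← one_add_one_eq_two, Finset.prod_range_succ, Finset.prod_range_one, pow_zero, mul_one,
    one_add_one_eq_two, pow_one] at h

theorem eulerE_eq_mul_eulerE_sq {p : ZQSeries} (hp : q ∣ p) :
    eulerE p = qPoch p (p ^ 2) * eulerE (p ^ 2) := by
  rw [eulerE_eq, eulerE_eq, qPoch_eq_mul_sq p hp, ← pow_two]

theorem eulerE_sq_div_eulerE_mem {p : ZQSeries} (hp : q ∣ p) (hpm : p ∈ nonnegSeries) :
    eulerE (p ^ 2) * Ring.inverse (eulerE p) ∈ nonnegSeries := by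
  have hp2 : q ∣ p ^ 2 := hp.trans (dvd_pow_self p two_ne_zero)
  rw [eulerE_eq_mul_eulerE_sq hp, Ring.mul_inverse_rev, ← mul_assoc,
    mul_inverse (isUnit_eulerE hp2), one_mul]
  exact inverse_qPoch_mem hp2 hp (pow_mem hpm 2) hpm

/-! ### Nonnegativity of the components -/

theorem prod_range_pairs_odd {M : Type*} [CommMonoid M] (f : ℕ → M) (m : ℕ) :
    ∏ j ∈ Finset.range (2 * m), f (j + 1) = ∏ j ∈ Finset.range m, f (j + 1) * f (2 * m - j) := by
  rw [two_mul, Finset.prod_range_add, Finset.prod_mul_distrib,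
    ← Finset.prod_range_reflect (fun j => f (m + j + 1))]
  congr 1
  refine Finset.prod_congr rfl fun j hj => ?_
  rw [Finset.mem_range] at hj
  congr 1; omega

theorem prod_range_pairs_even {M : Type*} [CommMonoid M] (f : ℕ → M) (m : ℕ) :
    ∏ j ∈ Finset.range (2 * m + 1), f (j + 1) =
      (∏ j ∈ Finset.range m, f (j + 1) * f (2 * m + 1 - j)) * f (m + 1) := by
  have h : ∏ j ∈ Finset.range m, f (m + 1 + j + 1) =
      ∏ j ∈ Finset.range m, f (2 * m + 1 - j) := by
    rw [← Finset.prod_range_reflect]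
    refine Finset.prod_congr rfl fun j hj => congrArg f ?_
    rw [Finset.mem_range] at hj
    omega
  have h' := Finset.prod_range_add (fun j => f (j + 1)) (m + 1) m
  rw [show m + 1 + m = 2 * m + 1 by ring, h, Finset.prod_range_succ _ m] at h'
  rw [h', Finset.prod_mul_distrib, mul_right_comm]

theorem eulerE_q_eq (a : ℕ) :
    eulerE q = (∏ j ∈ Finset.range a, qPoch (q ^ (j + 1)) (q ^ (a + 1))) *
      eulerE (q ^ (a + 1)) := by
  have h := qPoch_eq_prod_range q dvd_rfl a.succ_pos
  simp only [Nat.succ_eq_add_one, ← pow_succ'] at h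
  rw [eulerE_eq q, h, Finset.prod_range_succ, eulerE_eq]

/-- The exponents j+1 and a-j add up to a+1, so E(Q) over the j-th pair is nonnegative by
`eulerE_div_qPoch_mem`. The i-th pair cancels, and the other m-1 pairs consume E(Q)^(m-1). -/
theorem exists_prod_pairs {a m i : ℕ} (hi : i < m) (hm : 2 * m ≤ a) :
    ∃ H ∈ nonnegSeries, H * (∏ j ∈ Finset.range m, (qPoch (q ^ (j + 1)) (q ^ (a + 1)) *
        qPoch (q ^ (a - j)) (q ^ (a + 1)))) * eulerE (q ^ (a + 1)) =
      eulerE (q ^ (a + 1)) ^ m *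
        (qPoch (q ^ (i + 1)) (q ^ (a + 1)) * qPoch (q ^ (a - i)) (q ^ (a + 1))) := by
  have hQ : q ∣ q ^ (a + 1) := dvd_pow_self q a.succ_ne_zero
  have him : i ∈ Finset.range m := Finset.mem_range.2 hi
  refine ⟨∏ j ∈ (Finset.range m).erase i, eulerE (q ^ (a + 1)) *
    (Ring.inverse (qPoch (q ^ (j + 1)) (q ^ (a + 1))) *
      Ring.inverse (qPoch (q ^ (a - j)) (q ^ (a + 1)))), prod_mem fun j hj => ?_, ?_⟩
  · have hj' := Finset.mem_range.1 (Finset.mem_of_mem_erase hj)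
    refine eulerE_div_qPoch_mem ?_ (dvd_pow_self q j.succ_ne_zero) (dvd_pow_self q (by omega))
      (pow_mem q_mem_nonnegSeries _) (pow_mem q_mem_nonnegSeries _)
    rw [← pow_add]; congr 1; omega
  · rw [← Finset.mul_prod_erase _ _ him]
    have h : (∏ j ∈ (Finset.range m).erase i, eulerE (q ^ (a + 1)) *
        (Ring.inverse (qPoch (q ^ (j + 1)) (q ^ (a + 1))) *
          Ring.inverse (qPoch (q ^ (a - j)) (q ^ (a + 1))))) *
        ∏ j ∈ (Finset.range m).erase i, (qPoch (q ^ (j + 1)) (q ^ (a + 1)) *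
          qPoch (q ^ (a - j)) (q ^ (a + 1))) = eulerE (q ^ (a + 1)) ^ (m - 1) := by
      rw [← Finset.prod_mul_distrib]
      have h1 : ∀ j ∈ (Finset.range m).erase i, eulerE (q ^ (a + 1)) *
          (Ring.inverse (qPoch (q ^ (j + 1)) (q ^ (a + 1))) *
            Ring.inverse (qPoch (q ^ (a - j)) (q ^ (a + 1)))) *
          (qPoch (q ^ (j + 1)) (q ^ (a + 1)) * qPoch (q ^ (a - j)) (q ^ (a + 1))) =
          eulerE (q ^ (a + 1)) := by
        intro j hj
        have hj' := Finset.mem_range.1 (Finset.mem_of_mem_erase hj)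
        have e1 := mul_inverse (isUnit_qPoch hQ (dvd_pow_self q j.succ_ne_zero))
        have e2 := mul_inverse (isUnit_qPoch hQ (dvd_pow_self q (show a - j ≠ 0 by omega)))
        linear_combination eulerE (q ^ (a + 1)) * e1 + eulerE (q ^ (a + 1)) *
          (qPoch (q ^ (j + 1)) (q ^ (a + 1)) *
            Ring.inverse (qPoch (q ^ (j + 1)) (q ^ (a + 1)))) * e2
      rw [Finset.prod_congr rfl h1, Finset.prod_const, Finset.card_erase_of_mem him,
        Finset.card_range]
    have h2 : eulerE (q ^ (a + 1)) ^ m =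
        eulerE (q ^ (a + 1)) ^ (m - 1) * eulerE (q ^ (a + 1)) := by
      rw [← pow_succ]; congr 1; omega
    rw [h2, ← h]
    ring

theorem exists_mul_eulerE_of_lt {a i : ℕ} (h : 2 * (i + 1) < a + 1) :
    ∃ H ∈ nonnegSeries, H * eulerE q = eulerE (q ^ (a + 1)) ^ ((a + 1) / 2) *
      (qPoch (q ^ (i + 1)) (q ^ (a + 1)) * qPoch (q ^ (a - i)) (q ^ (a + 1))) := by
  have hE := eulerE_q_eq a
  obtain ⟨m, rfl | rfl⟩ := Nat.even_or_odd' a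
  · obtain ⟨H, hH, e⟩ := exists_prod_pairs (a := 2 * m) (m := m) (i := i) (by omega) le_rfl
    rw [prod_range_pairs_odd fun j => qPoch (q ^ j) (q ^ (2 * m + 1))] at hE
    refine ⟨H, hH, ?_⟩
    rw [hE, ← mul_assoc, e, show (2 * m + 1) / 2 = m by omega]
  -- For odd a the unpaired residue p = q^(m+1) satisfies p^2 = Q. The extra power of E(Q) pays for
  -- it: E(Q)/(p;p^2)_∞ = E(p^2)^2/E(p), the 2-core series.
  · obtain ⟨H, hH, e⟩ := exists_prod_pairs (a := 2 * m + 1) (m := m) (i := i) (by omega) (by omega)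
    rw [prod_range_pairs_even fun j => qPoch (q ^ j) (q ^ (2 * m + 1 + 1))] at hE
    have hp : q ∣ q ^ (m + 1) := dvd_pow_self q m.succ_ne_zero
    have hc := eulerE_pow_div_eulerE_mem hp (pow_mem q_mem_zFreeSeries _)
      (pow_mem q_mem_nonnegSeries _) two_pos
    have h2 := eulerE_eq_mul_eulerE_sq hp
    have hu := mul_inverse (isUnit_eulerE hp)
    have hpp : (q ^ (m + 1)) ^ 2 = q ^ (2 * m + 1 + 1) := by rw [← pow_mul]; congr 1; ring
    rw [hpp] at hc h2
    refine ⟨_, mul_mem hH hc, ?_⟩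
    rw [show (2 * m + 1 + 1) / 2 = m + 1 by omega, pow_succ (eulerE _) m, hE]
    set E := eulerE (q ^ (2 * m + 1 + 1))
    set P := qPoch (q ^ (m + 1)) (q ^ (2 * m + 1 + 1))
    set I := Ring.inverse (eulerE (q ^ (m + 1)))
    rw [h2] at hu
    linear_combination (E ^ 2 * I * P) * e + (E ^ m * E *
      (qPoch (q ^ (i + 1)) (q ^ (2 * m + 1 + 1)) *
        qPoch (q ^ (2 * m + 1 - i)) (q ^ (2 * m + 1 + 1)))) * hu

theorem exists_mul_eulerE {a i : ℕ} (hi : i < a) (h : 2 * (i + 1) ≠ a + 1) :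
    ∃ H ∈ nonnegSeries, H * eulerE q = eulerE (q ^ (a + 1)) ^ ((a + 1) / 2) *
      (qPoch (q ^ (i + 1)) (q ^ (a + 1)) * qPoch (q ^ (a - i)) (q ^ (a + 1))) := by
  rcases lt_or_gt_of_ne h with h | h
  · exact exists_mul_eulerE_of_lt h
  · obtain ⟨H, hH, e⟩ := exists_mul_eulerE_of_lt (a := a) (i := a - i - 1) (by omega)
    refine ⟨H, hH, ?_⟩
    rw [e, show a - (a - i - 1) = i + 1 by omega, show a - i - 1 + 1 = a - i by omega]
    ring

/-- With p = q^s, E(p^2)^s E(p)/E(q) is the product of E(p)^s/E(q) (s-cores), E(p^2)^2/E(p)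
(2-cores) and (E(p^2)/E(p))^(s-2), where E(p^2)/E(p) = 1/(p;p^2)_∞. -/
theorem exists_middle {s : ℕ} (hs : 2 ≤ s) :
    ∃ H ∈ nonnegSeries, H * eulerE q = eulerE ((q ^ s) ^ 2) ^ s * eulerE (q ^ s) := by
  obtain ⟨j, rfl⟩ := Nat.exists_eq_add_of_le' hs
  have hp : q ∣ q ^ (j + 2) := dvd_pow_self q (by omega)
  have hpz := pow_mem q_mem_zFreeSeries (j + 2)
  have hpm := pow_mem q_mem_nonnegSeries (j + 2)
  have m1 := eulerE_pow_div_eulerE_mem dvd_rfl q_mem_zFreeSeries q_mem_nonnegSeries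
    (show 0 < j + 2 by omega)
  have m2 := eulerE_pow_div_eulerE_mem hp hpz hpm two_pos
  have m3 := pow_mem (eulerE_sq_div_eulerE_mem hp hpm) j
  refine ⟨_, mul_mem (mul_mem m1 m2) m3, ?_⟩
  have h1 := mul_inverse (isUnit_eulerE (dvd_refl q))
  have h2 : eulerE (q ^ (j + 2)) ^ (j + 1) * Ring.inverse (eulerE (q ^ (j + 2))) ^ (j + 1) = 1 := by
    rw [← mul_pow, mul_inverse (isUnit_eulerE hp), one_pow]
  rw [mul_pow (eulerE ((q ^ (j + 2)) ^ 2))]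
  set E := eulerE ((q ^ (j + 2)) ^ 2)
  set P := eulerE (q ^ (j + 2))
  linear_combination (E ^ (j + 2) * P * P ^ (j + 1) * Ring.inverse P ^ (j + 1)) * h1 +
    (E ^ (j + 2) * P) * h2

theorem exists_component {a k i : ℕ} (ha : 2 ≤ a) (hk : 2 ≤ k) (hi : i < a) :
    ∃ F ∈ nonnegSeries, F * eulerE q * (bracket (z ^ (a + 1)) (q ^ (a + 1)) *
        (qPoch ((((z ^ (a + 1))⁻¹ : ZQSeriesˣ) : ZQSeries) * q ^ (i + 1)) (q ^ (a + 1)) *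
          qPoch (((z ^ (a + 1) : ZQSeriesˣ) : ZQSeries) * q ^ (a - i)) (q ^ (a + 1)))) =
      (1 - (z : ZQSeries) ^ (k * (a + 1))) * eulerE (q ^ (a + 1)) ^ ((a + 1) / 2) *
        (eulerE (q ^ (a + 1)) ^ 2 *
          (qPoch (q ^ (i + 1)) (q ^ (a + 1)) * qPoch (q ^ (a - i)) (q ^ (a + 1)))) := by
  have hx : ((z ^ (a + 1) : ZQSeriesˣ) : ZQSeries) ∈ nonnegSeries := by
    exact_mod_cast zpow_mem_nonnegSeries ((a + 1 : ℕ) : ℤ)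
  have hx' : (((z ^ (a + 1))⁻¹ : ZQSeriesˣ) : ZQSeries) ∈ nonnegSeries := by
    have := zpow_mem_nonnegSeries (-((a + 1 : ℕ) : ℤ))
    rwa [zpow_neg, zpow_natCast] at this
  have hzk : (z : ZQSeries) ^ (k * (a + 1)) = ((z ^ (a + 1) : ZQSeriesˣ) : ZQSeries) ^ k := by
    rw [Units.val_pow_eq_pow_val, ← pow_mul, mul_comm]
  have hQ : q ∣ q ^ (a + 1) := dvd_pow_self q a.succ_ne_zero
  have hqm := pow_mem q_mem_nonnegSeries
  have hxx := Units.mul_inv (z ^ (a + 1))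
  rw [hzk]
  rcases eq_or_ne (2 * (i + 1)) (a + 1) with h | h
  -- Middle residue: with p = q^(i+1) and Q = p^2, [x;Q] and the two products at p/x and px
  -- recombine to [x;p], so the crank argument applies in base p. Here a ≥ 2 forces i+1 ≥ 2, as
  -- `exists_middle` needs.
  · have hp : q ∣ q ^ (i + 1) := dvd_pow_self q i.succ_ne_zero
    obtain ⟨A, hA, e1⟩ := exists_mul_bracket_eq (z ^ (a + 1)) hp (hqm _) hx hx' hk
    obtain ⟨H, hH, e2⟩ := exists_middle (s := i + 1) (by omega)
    have e3 := eulerE_eq_mul_eulerE_sq hp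
    have hpp : (q ^ (i + 1)) ^ 2 = q ^ (a + 1) := by rw [← pow_mul, ← h]; congr 1; ring
    have e4 := fun x => qPoch_eq_mul_sq x hp
    rw [hpp] at e2 e3
    simp only [hpp] at e4
    rw [show a - i = i + 1 by omega, show (a + 1) / 2 = i + 1 by omega]
    rw [bracket, e4, e4, mul_assoc _ (q ^ (i + 1)) (q ^ (i + 1)), ← pow_two (q ^ (i + 1)), hpp]
      at e1
    refine ⟨_, mul_mem hA hH, ?_⟩
    rw [bracket]
    set Q := q ^ (a + 1)
    set P := qPoch (q ^ (i + 1)) Q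
    rw [e3] at e1 e2
    linear_combination (H * eulerE q) * e1 +
      (1 - ((z ^ (a + 1) : ZQSeriesˣ) : ZQSeries) ^ k) * (P * eulerE Q) * e2
  · obtain ⟨A, hA, e1⟩ := exists_mul_bracket_eq (z ^ (a + 1)) hQ (hqm _) hx hx' hk
    obtain ⟨H, hH, e2⟩ := exists_mul_eulerE hi h
    have d1 : q ∣ (((z ^ (a + 1))⁻¹ : ZQSeriesˣ) : ZQSeries) * q ^ (i + 1) :=
      (dvd_pow_self q i.succ_ne_zero).mul_left _
    have d2 : q ∣ ((z ^ (a + 1) : ZQSeriesˣ) : ZQSeries) * q ^ (a - i) :=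
      (dvd_pow_self q (by omega)).mul_left _
    have hB := eulerE_div_qPoch_mem (Q := q ^ (a + 1)) (by
      have : q ^ (a - i) * q ^ (i + 1) = q ^ (a + 1) := by rw [← pow_add]; congr 1; omega
      rw [← this]
      linear_combination (q ^ (a - i) * q ^ (i + 1)) * hxx) d1 d2 (mul_mem hx' (hqm _))
      (mul_mem hx (hqm _))
    refine ⟨_, mul_mem (mul_mem hA hB) hH, ?_⟩
    have u1 := mul_inverse (isUnit_qPoch hQ d1)
    have u2 := mul_inverse (isUnit_qPoch hQ d2)
    set Q := q ^ (a + 1)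
    set R1 := qPoch ((((z ^ (a + 1))⁻¹ : ZQSeriesˣ) : ZQSeries) * q ^ (i + 1)) Q
    set R2 := qPoch (((z ^ (a + 1) : ZQSeriesˣ) : ZQSeries) * q ^ (a - i)) Q
    set W := bracket (z ^ (a + 1)) Q
    linear_combination (A * W * eulerE Q * H * eulerE q * R2 * Ring.inverse R2) * u1 +
      (A * W * eulerE Q * H * eulerE q) * u2 + (eulerE Q * H * eulerE q) * e1 +
      ((1 - ((z ^ (a + 1) : ZQSeriesˣ) : ZQSeries) ^ k) * eulerE Q ^ 2) * e2

end QSeries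

/-! ### Assembly of the components -/

theorem mainTheorem5 (a k : ℕ) (ha : 2 ≤ a) (hk : 2 ≤ k) :
    ∃ F : QSeries.ZQSeries,
      (∀ G : QSeries.ZQSeries,
        G * (QSeries.bracket QSeries.z QSeries.q *
            QSeries.bracket (QSeries.z ^ (a + 1)) QSeries.q) =
          (1 - (QSeries.z : QSeries.ZQSeries) ^ (k * (a + 1))) * QSeries.eulerE QSeries.q *
            QSeries.eulerE (QSeries.q ^ (a + 1)) ^ ((a + 1) / 2) *
            QSeries.bracket (QSeries.z ^ a) QSeries.q
        ↔ G = F) ∧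
      QSeries.Nonneg F := by
  open QSeries in
  have hQ : q ∣ q ^ (a + 1) := dvd_pow_self q a.succ_ne_zero
  have hb1 : bracket z q ≠ 0 := by
    simpa using bracket_z_pow_ne_zero one_ne_zero (dvd_refl q)
  have hb2 : bracket (z ^ (a + 1)) q ≠ 0 := bracket_z_pow_ne_zero a.succ_ne_zero dvd_rfl
  have hb3 : bracket (z ^ (a + 1)) (q ^ (a + 1)) ≠ 0 :=
    bracket_z_pow_ne_zero a.succ_ne_zero hQ
  have hz : (1 - (z : ZQSeries) ^ (a + 1)) ≠ 0 := by
    refine sub_ne_zero.2 (Ne.symm ?_)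
    exact_mod_cast z_pow_ne_one (n := ((a + 1 : ℕ) : ℤ)) (by omega)
  choose! f hf hfe using fun i (hi : i < a) => exists_component ha hk hi
  -- Both `exists_component` and the residue identity describe the same theta quotient; cancelling
  -- its nonzero denominator ties f i to the residue factor.
  have hres : ∀ i ∈ Finset.range a, f i * eulerE q * (1 - (z : ZQSeries) ^ (a + 1)) =
      (1 - (z : ZQSeries) ^ (k * (a + 1))) * eulerE (q ^ (a + 1)) ^ ((a + 1) / 2) *
        residueFactor a i := by
    intro i hi
    rw [Finset.mem_range] at hi
    have hd := eulerE_sq_mul_qPoch_residue hi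
    have hu := mul_ne_zero hb3 (mul_ne_zero
      (isUnit_qPoch hQ ((dvd_pow_self q i.succ_ne_zero).mul_left
        (((z ^ (a + 1))⁻¹ : ZQSeriesˣ) : ZQSeries))).ne_zero
      (isUnit_qPoch hQ ((dvd_pow_self q (show a - i ≠ 0 by omega)).mul_left
        ((z ^ (a + 1) : ZQSeriesˣ) : ZQSeries))).ne_zero)
    apply mul_right_cancel₀ hu
    linear_combination (1 - (z : ZQSeries) ^ (a + 1)) * hfe i hi +
      ((1 - (z : ZQSeries) ^ (k * (a + 1))) * eulerE (q ^ (a + 1)) ^ ((a + 1) / 2)) * hd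
  refine ⟨∑ i ∈ Finset.range a, (z : ZQSeries) ^ i * f i, fun G => ?_, ?_⟩
  · have key : (∑ i ∈ Finset.range a, (z : ZQSeries) ^ i * f i) *
        (bracket z q * bracket (z ^ (a + 1)) q) =
        (1 - (z : ZQSeries) ^ (k * (a + 1))) * eulerE q *
          eulerE (q ^ (a + 1)) ^ ((a + 1) / 2) * bracket (z ^ a) q := by
      have hsum : (∑ i ∈ Finset.range a, (z : ZQSeries) ^ i * f i) *
          (eulerE q * (1 - (z : ZQSeries) ^ (a + 1))) =
          (1 - (z : ZQSeries) ^ (k * (a + 1))) * eulerE (q ^ (a + 1)) ^ ((a + 1) / 2) *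
            ∑ i ∈ Finset.range a, (z : ZQSeries) ^ i * residueFactor a i := by
        rw [Finset.sum_mul, Finset.mul_sum]
        refine Finset.sum_congr rfl fun i hi => ?_
        linear_combination (z : ZQSeries) ^ i * hres i hi
      have hd := eulerE_sq_mul_bracket a
      apply mul_right_cancel₀ (mul_ne_zero (isUnit_eulerE (dvd_refl q)).ne_zero hz)
      linear_combination (bracket z q * bracket (z ^ (a + 1)) q) * hsum -
        ((1 - (z : ZQSeries) ^ (k * (a + 1))) * eulerE (q ^ (a + 1)) ^ ((a + 1) / 2)) * hd
    rw [← key]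
    -- Uniqueness: the ring is a domain and both brackets are nonzero.
    exact (mul_left_injective₀ (mul_ne_zero hb1 hb2)).eq_iff
  · have : ∑ i ∈ Finset.range a, (z : ZQSeries) ^ i * f i ∈ nonnegSeries :=
      sum_mem fun i hi => mul_mem (pow_mem z_mem_nonnegSeries i) (hf i (Finset.mem_range.1 hi))
    exact this
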